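/- **Theorem (maximal estimate along curves on small Euclidean annuli).** Let $n\ge 2$. For $\mu\ge 0$ let $\mathscr{J}_\mu(z)=2^\mu\,\pi^{1/2}\,\Gamma(\mu+\tfrac12)\,J_\mu(z)/z^\mu$ (with its limit value at $z=0$), where $J_\mu$ is the Bessel function. For a radial Schwartz function $f$ on $\mathbb{R}^n$, $f(x)=f(s)$ with $s=\|x\|$, put $$\mathscr{F}f(\lambda)=\int_0^\infty f(s)\,\mathscr{J}_{\frac{n-2}{2}}(\lambda s)\,s^{n-1}\,ds,\qquad \tilde S_tf(s)=\int_0^\infty \mathscr{J}_{\frac{n-2}{2}}(\lambda s)\,e^{it\lambda^2}\,\mathscr{F}f(\lambda)\,\lambda^{n-1}\,d\lambda,$$ $$\|f\|_{\dot H^{1/4}(\mathbb{R}^n)}=\Big(\int_0^\infty \lambda^{1/2}\,|\mathscr{F}f(\lambda)|^2\,\lambda^{n-1}\,d\lambda\Big)^{1/2}.$$ There is $\varepsilon_0>0$, depending only on $n$, with the following property. Let $C_4,C_5,C_6>0$ be fixed constants and let $0<\delta_1<\delta_2$ be so small that $C_6\,\delta_2\le\varepsilon_0$. Then there is a constant $C>0$,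 depending only on $\delta_1,\delta_2,n$ and the fixed constants $C_4,C_5,C_6$, such that the following holds for every $\alpha\in[\tfrac12,1]$, every $T$ with $$0<T<\Big(\frac{C_5\,\delta_1}{2C_4}\Big)^{1/\alpha},$$ and every family of curves $\gamma_s:\mathbb{R}\to\mathbb{R}^n$ ($s\ge 0$) with $\|\gamma_s(0)\|=s$ for $s\in[0,\delta_2)$ which satisfies, for all $s,s'\in[0,\delta_2)$ and $t,t'\in[-T,T]$, $$(\mathscr{H}_3)\quad \big|\,\|\gamma_s(t)\|-\|\gamma_s(t')\|\,\big|\le C_4\,|t-t'|^\alpha,$$ $$(\mathscr{H}_4)\quad C_5\,|s-s'|\le\big|\,\|\gamma_s(t)\|-\|\gamma_{s'}(t)\|\,\big|\le C_6\,|s-s'|.$$ For all radial Schwartz functions $f$ on $\mathbb{R}^n$, $$\Big(\int_{\delta_1}^{\delta_2}\Big(\sup_{t\in[-T,T]}\big|\tilde S_tf(\|\gamma_s(t)\|)\big|\Big)^2 s^{n-1}\,ds\Big)^{1/2}\le C\,\|f\|_{\dot H^{1/4}(\mathbb{R}^n)}.$$ -/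

import Mathlib

open MeasureTheory Set
open scoped ENNReal

noncomputable section

namespace RadialSchrodinger

/-- The Bessel function `J_μ` (for `μ > -1/2` and `z ≥ 0`), given by Poisson's integral
`J_μ(z) = (z/2)^μ / (Γ(μ + 1/2) Γ(1/2)) ∫_{-1}^{1} e^{izu} (1 - u²)^{μ - 1/2} du`. -/
def besselJ (μ z : ℝ) : ℂ :=
  (((z / 2) ^ μ / (Real.Gamma (μ + 1 / 2) * Real.Gamma (1 / 2)) : ℝ) : ℂ) *
    ∫ u in (-1 : ℝ)..1, Complex.exp (Complex.I * z * u) * (((1 - u ^ 2) ^ (μ - 1 / 2) : ℝ) : ℂ)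

/-- The modified Bessel function `𝒥_μ(z) = 2^μ √π Γ(μ + 1/2) J_μ(z) / z^μ`. It is written as
`∫_{-1}^{1} e^{izu} (1 - u²)^{μ - 1/2} du`, which includes the limit value at `z = 0`;
`modifiedBesselJ_eq` below is the defining formula for `z > 0`. -/
def modifiedBesselJ (μ z : ℝ) : ℂ :=
  ∫ u in (-1 : ℝ)..1, Complex.exp (Complex.I * z * u) * (((1 - u ^ 2) ^ (μ - 1 / 2) : ℝ) : ℂ)

theorem modifiedBesselJ_eq {μ z : ℝ} (hμ : 0 ≤ μ) (hz : 0 < z) :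
    modifiedBesselJ μ z =
      ((2 ^ μ * Real.pi ^ (1 / 2 : ℝ) * Real.Gamma (μ + 1 / 2) : ℝ) : ℂ) *
        besselJ μ z / ((z ^ μ : ℝ) : ℂ) := by
  have hG : Real.Gamma (μ + 1 / 2) ≠ 0 := (Real.Gamma_pos_of_pos (by linarith)).ne'
  have hp : Real.pi ^ (1 / 2 : ℝ) ≠ 0 := (Real.rpow_pos_of_pos Real.pi_pos _).ne'
  have hzμ : z ^ μ ≠ 0 := (Real.rpow_pos_of_pos hz _).ne'
  have h2 : (2 : ℝ) ^ μ ≠ 0 := (Real.rpow_pos_of_pos two_pos _).ne'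
  have hc : (2 ^ μ * Real.pi ^ (1 / 2 : ℝ) * Real.Gamma (μ + 1 / 2)) *
      ((z / 2) ^ μ / (Real.Gamma (μ + 1 / 2) * Real.Gamma (1 / 2))) = z ^ μ := by
    rw [Real.Gamma_one_half_eq, Real.sqrt_eq_rpow, Real.div_rpow hz.le two_pos.le]
    field_simp
  rw [besselJ, ← mul_assoc, ← Complex.ofReal_mul, hc, mul_div_assoc, modifiedBesselJ]
  rw [← mul_div_assoc, mul_div_cancel_left₀]
  exact_mod_cast hzμ

/-- The Euclidean spherical Fourier transform on `ℝⁿ` of the radial function `x ↦ f₀ ‖x‖`: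
`ℱf(l) = ∫_0^∞ f₀(s) 𝒥_{(n-2)/2}(l s) s^{n-1} ds`. -/
def sphericalFourier (n : ℕ) (f₀ : ℝ → ℂ) (l : ℝ) : ℂ :=
  ∫ s in Ioi (0 : ℝ), f₀ s * modifiedBesselJ (((n : ℝ) - 2) / 2) (l * s) * ((s ^ (n - 1) : ℝ) : ℂ)

/-- The solution at time `t` and at distance `s` from the origin of the Schrödinger equation on
`ℝⁿ` with the radial initial datum `x ↦ f₀ ‖x‖`:
`S̃_t f(s) = ∫_0^∞ 𝒥_{(n-2)/2}(l s) e^{itl²} ℱf(l) l^{n-1} dl`. -/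
def schrodingerRadial (n : ℕ) (f₀ : ℝ → ℂ) (t s : ℝ) : ℂ :=
  ∫ l in Ioi (0 : ℝ), modifiedBesselJ (((n : ℝ) - 2) / 2) (l * s) *
    Complex.exp (Complex.I * t * ((l ^ 2 : ℝ) : ℂ)) * sphericalFourier n f₀ l *
      ((l ^ (n - 1) : ℝ) : ℂ)

/-- The homogeneous Sobolev norm on `ℝⁿ` of the radial function `x ↦ f₀ ‖x‖`:
`‖f‖_{Ḣ^β} = (∫_0^∞ l^{2β} |ℱf(l)|² l^{n-1} dl)^{1/2}`, as an extended nonnegative number. -/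
def homSobolevNorm (n : ℕ) (β : ℝ) (f₀ : ℝ → ℂ) : ℝ≥0∞ :=
  (∫⁻ l in Ioi (0 : ℝ), ENNReal.ofReal (l ^ (2 * β)) * ‖sphericalFourier n f₀ l‖ₑ ^ 2 *
    ENNReal.ofReal (l ^ (n - 1))) ^ (1 / 2 : ℝ)

/-- Hölder condition in time on the norms of the curves `γ_s`, for `s ∈ [0, δ)` and
`t, t' ∈ [-T, T]`. -/
def HolderInTime {n : ℕ} (γ : ℝ → ℝ → EuclideanSpace ℝ (Fin n)) (δ T α C₄ : ℝ) : Prop :=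
  ∀ s ∈ Ico 0 δ, ∀ t ∈ Icc (-T) T, ∀ t' ∈ Icc (-T) T,
    |‖γ s t‖ - ‖γ s t'‖| ≤ C₄ * |t - t'| ^ α

/-- Bilipschitz condition in the parameter `s` on the norms of the curves `γ_s`, for
`s, s' ∈ [0, δ)` and `t ∈ [-T, T]`. -/
def BilipschitzInSpace {n : ℕ} (γ : ℝ → ℝ → EuclideanSpace ℝ (Fin n)) (δ T C₅ C₆ : ℝ) : Prop :=
  ∀ s ∈ Ico 0 δ, ∀ s' ∈ Ico 0 δ, ∀ t ∈ Icc (-T) T,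
    C₅ * |s - s'| ≤ |‖γ s t‖ - ‖γ s' t‖| ∧ |‖γ s t‖ - ‖γ s' t‖| ≤ C₆ * |s - s'|

end RadialSchrodinger

end

/-!
The radial evolution is reduced to a one-dimensional one, for which the maximal function is
linearized and treated by the `TT*` method.

Put `m = (n - 1) / 2` and `h(l) = l^m ℱf(l)`, so that `‖f‖²` in the homogeneous Sobolev space of
order `1/4` is `∫ √l |h(l)|² dl`. The function `W(z) = z^m 𝒥(z)` solves
`W'' + W = (m (m - 1) / z²) W`, hence `W(z) = c₁ e^{iz} + c₂ e^{-iz} + O(1/z)` at infinity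
(`exists_modifiedBesselJ_asymptotics`). Because of the Hölder condition and the bound on `T`, the
radii `r_s(t) = ‖γ_s(t)‖` with `s ∈ (δ₁, δ₂)` lie in a fixed compact subset of `(0, ∞)`. There
`r_s(t)^m` times the solution is a combination of two one-dimensional evolutions
`∫_1^∞ e^{i(± l r_s(t) + t l²)} h(l) dl`, up to an error dominated by `∫ min(1, 1/l) |h(l)| dl`,
which the Cauchy–Schwarz inequality controls (`norm_integral_besselKernel_le`,
`exists_lintegral_errorWeight_mul_le`).

For the one-dimensional evolution with a measurable choice `t(s)` of the time, the `TT*` kernel is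
`∫ e^{i(al + bl²)} l^{-1/2} dl` with `a = ±(r_s(t) - r_{s'}(t'))` and `b = t - t'`. Van der Corput's
tests bound it by constant multiples of `|a|^{-1/2}` and of `|b|^{-1/4}`, uniformly in the other
parameter and in the truncation (`norm_oscKernel_le_linear`, `norm_oscKernel_le_quadratic`). By the
bilipschitz condition, either `C₄ |b|^α ≥ C₅ |s - s'| / 2`, and then `|b| ≥ c |s - s'|²` because
`α ≥ 1/2`, or `|a| ≥ C₅ |s - s'| / 2`. In both cases the kernel is `O(|s - s'|^{-1/2})`
(`exists_norm_oscKernel_curve_le`), which is integrable, and Schur's test applies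
(`integral_sq_norm_integral_le`).

The estimates are uniform in a frequency truncation `l ≤ R`, which is removed at the end by Fatou's
lemma (`lintegral_iSup_besselEvolution_sq_le`).
-/

namespace RadialSchrodinger

/-! ### Oscillatory integrals with quadratic phase -/

open Complex (exp I) in
/-- First derivative test for a quadratic phase with a nonnegative decreasing amplitude. -/
theorem norm_integral_quadratic_phase_le_of_le_abs_deriv {w w' : ℝ → ℝ} {a b A B m : ℝ}
    (hAB : A ≤ B) (hm : 0 < m) (hw : ∀ l ∈ Icc A B, HasDerivAt w (w' l) l)
    (hw'c : ContinuousOn w' (Icc A B)) (hw' : ∀ l ∈ Icc A B, w' l ≤ 0)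
    (hw0 : ∀ l ∈ Icc A B, 0 ≤ w l) (hφ : ∀ l ∈ Icc A B, m ≤ |a + 2 * b * l|) :
    ‖∫ l in A..B, (w l : ℂ) * exp (I * ((a * l + b * l ^ 2 : ℝ) : ℂ))‖ ≤ 5 * w A / m := by
  have hIcc : uIcc A B = Icc A B := uIcc_of_le hAB
  have hAm : A ∈ Icc A B := left_mem_Icc.2 hAB
  have hBm : B ∈ Icc A B := right_mem_Icc.2 hAB
  have hφ0 : ∀ l ∈ Icc A B, a + 2 * b * l ≠ 0 := fun l hl h0 => by
    have := hφ l hl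
    rw [h0, abs_zero] at this
    linarith
  have hwc : ContinuousOn w (Icc A B) := fun l hl => (hw l hl).continuousAt.continuousWithinAt
  have hanti : ∀ l ∈ Icc A B, w l ≤ w A := by
    have : AntitoneOn w (Icc A B) := antitoneOn_of_hasDerivWithinAt_nonpos (convex_Icc A B) hwc
      (fun l hl => (hw l (interior_subset hl)).hasDerivWithinAt)
      (fun l hl => hw' l (interior_subset hl))
    exact fun l hl => this hAm hl hl.1
  have hexp : ∀ l : ℝ, HasDerivAt (fun l : ℝ => exp (I * ((a * l + b * l ^ 2 : ℝ) : ℂ)))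
      (exp (I * ((a * l + b * l ^ 2 : ℝ) : ℂ)) * (I * ((a + 2 * b * l : ℝ) : ℂ))) l := by
    intro l
    have h1 : HasDerivAt (fun l : ℝ => a * l + b * l ^ 2) (a + 2 * b * l) l := by
      have := ((hasDerivAt_id l).const_mul a).add (((hasDerivAt_id l).pow 2).const_mul b)
      refine this.congr_deriv ?_
      simp; ring
    exact (h1.ofReal_comp.const_mul I).cexp
  have hexpn : ∀ l : ℝ, ‖exp (I * ((a * l + b * l ^ 2 : ℝ) : ℂ))‖ = 1 := fun l => by
    rw [mul_comm, Complex.norm_exp_ofReal_mul_I]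
  have hlin : ∀ l : ℝ, HasDerivAt (fun l : ℝ => a + 2 * b * l) (2 * b) l := fun l => by
    simpa using ((hasDerivAt_id l).const_mul (2 * b)).const_add a
  have hlinc : Continuous fun l : ℝ => a + 2 * b * l := by fun_prop
  -- integration by parts against `e^{iφ} = (e^{iφ})' / (iφ')`
  set P : ℝ → ℂ := fun l => ((w l / (a + 2 * b * l) : ℝ) : ℂ) *
    exp (I * ((a * l + b * l ^ 2 : ℝ) : ℂ)) with hP
  set Q : ℝ → ℂ := fun l =>
    (((w' l * (a + 2 * b * l) - w l * (2 * b)) / (a + 2 * b * l) ^ 2 : ℝ) : ℂ) *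
      exp (I * ((a * l + b * l ^ 2 : ℝ) : ℂ)) with hQ
  have hcE : Continuous fun l : ℝ => exp (I * ((a * l + b * l ^ 2 : ℝ) : ℂ)) := by fun_prop
  have hPd : ∀ l ∈ uIcc A B, HasDerivAt P
      (Q l + I * ((w l : ℂ) * exp (I * ((a * l + b * l ^ 2 : ℝ) : ℂ)))) l := by
    intro l hl
    rw [hIcc] at hl
    have h0 := hφ0 l hl
    have := (((hw l hl).div (hlin l) h0).ofReal_comp).mul (hexp l)
    refine this.congr_deriv ?_
    have key : ((w l / (a + 2 * b * l) : ℝ) : ℂ) * ((a + 2 * b * l : ℝ) : ℂ) = w l := by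
      rw [← Complex.ofReal_mul, div_mul_cancel₀ _ h0]
    simp only [hQ, Pi.div_apply]
    linear_combination (exp (I * ((a * l + b * l ^ 2 : ℝ) : ℂ)) * I) * key
  have hiw : IntervalIntegrable (fun l => (w l : ℂ) * exp (I * ((a * l + b * l ^ 2 : ℝ) : ℂ)))
      volume A B := by
    apply ContinuousOn.intervalIntegrable
    rw [hIcc]
    exact (Complex.continuous_ofReal.comp_continuousOn hwc).mul hcE.continuousOn
  have hiQ : IntervalIntegrable Q volume A B := by
    apply ContinuousOn.intervalIntegrable
    rw [hIcc]
    refine (Complex.continuous_ofReal.comp_continuousOn ?_).mul hcE.continuousOn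
    exact ((hw'c.mul hlinc.continuousOn).sub (hwc.mul continuousOn_const)).div
      (hlinc.pow 2).continuousOn fun l hl => pow_ne_zero 2 (hφ0 l hl)
  have hFTC := intervalIntegral.integral_eq_sub_of_hasDerivAt hPd (hiQ.add (hiw.const_mul I))
  rw [intervalIntegral.integral_add hiQ (hiw.const_mul I),
    intervalIntegral.integral_const_mul] at hFTC
  set J := ∫ l in A..B, (w l : ℂ) * exp (I * ((a * l + b * l ^ 2 : ℝ) : ℂ))
  have hJ : ‖J‖ = ‖P B - P A - ∫ l in A..B, Q l‖ := by
    rw [← hFTC, add_sub_cancel_left, norm_mul, Complex.norm_I, one_mul]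
  have hPn : ∀ l ∈ Icc A B, ‖P l‖ ≤ w l / m := by
    intro l hl
    simp only [hP]
    rw [norm_mul, hexpn, mul_one, Complex.norm_real, Real.norm_eq_abs, abs_div,
      abs_of_nonneg (hw0 l hl)]
    exact div_le_div_of_nonneg_left (hw0 l hl) hm (hφ l hl)
  have hG : ∀ l ∈ uIcc A B, HasDerivAt (fun l => - (w l / m) - w A * (SignType.sign b : ℝ) *
      (a + 2 * b * l)⁻¹) (- (w' l / m) + w A * (2 * |b|) / (a + 2 * b * l) ^ 2) l := by
    intro l hl
    rw [hIcc] at hl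
    have h0 := hφ0 l hl
    have := ((hw l hl).div_const m).neg.sub
      (((hlin l).fun_inv h0).const_mul (w A * (SignType.sign b : ℝ)))
    refine this.congr_deriv ?_
    rw [show |b| = SignType.sign b * b from (sign_mul_self b).symm]
    ring
  have hiG : IntervalIntegrable
      (fun l => - (w' l / m) + w A * (2 * |b|) / (a + 2 * b * l) ^ 2) volume A B := by
    apply ContinuousOn.intervalIntegrable
    rw [hIcc]
    exact (hw'c.div_const m).neg.add (continuousOn_const.div
      (hlinc.pow 2).continuousOn fun l hl => pow_ne_zero 2 (hφ0 l hl))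
  have hQn : ‖∫ l in A..B, Q l‖ ≤
      ∫ l in A..B, - (w' l / m) + w A * (2 * |b|) / (a + 2 * b * l) ^ 2 := by
    refine intervalIntegral.norm_integral_le_of_norm_le hAB
      (Filter.Eventually.of_forall fun l hl => ?_) hiG
    have hl : l ∈ Icc A B := Ioc_subset_Icc_self hl
    have h0 := hφ0 l hl
    have hp : 0 < |a + 2 * b * l| := abs_pos.2 h0
    simp only [hQ]
    rw [norm_mul, hexpn, mul_one, Complex.norm_real, Real.norm_eq_abs]
    have e : (w' l * (a + 2 * b * l) - w l * (2 * b)) / (a + 2 * b * l) ^ 2 =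
        w' l / (a + 2 * b * l) - w l * (2 * b) / (a + 2 * b * l) ^ 2 := by
      field_simp
    rw [e]
    refine (abs_sub _ _).trans (add_le_add ?_ ?_)
    · rw [abs_div, abs_of_nonpos (hw' l hl), neg_div]
      rw [neg_le_neg_iff, div_le_div_iff₀ hm hp]
      nlinarith [hφ l hl, hw' l hl]
    · rw [abs_div, abs_mul, abs_mul, abs_two, abs_of_nonneg (hw0 l hl),
        abs_of_nonneg (sq_nonneg (a + 2 * b * l))]
      gcongr
      exact hanti l hl
  rw [intervalIntegral.integral_eq_sub_of_hasDerivAt hG hiG] at hQn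
  have hs : |(SignType.sign b : ℝ)| ≤ 1 := by
    rcases lt_trichotomy b 0 with h | h | h <;> simp [h]
  have hterm : ∀ l ∈ Icc A B, |w A * (SignType.sign b : ℝ) * (a + 2 * b * l)⁻¹| ≤ w A / m := by
    intro l hl
    rw [abs_mul, abs_mul, abs_inv, abs_of_nonneg (hw0 A hAm), div_eq_mul_inv]
    have h2 := inv_anti₀ hm (hφ l hl)
    have h3 := hw0 A hAm
    gcongr
    calc w A * |(SignType.sign b : ℝ)| ≤ w A * 1 := by gcongr
      _ = w A := mul_one _
  have hA' := abs_le.1 (hterm A hAm)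
  have hB' := abs_le.1 (hterm B hBm)
  have h5 : 5 * w A / m = 5 * (w A / m) := by ring
  have hBA : w B / m ≤ w A / m := by have := hanti B hBm; gcongr
  rw [hJ, h5]
  have t1 := norm_sub_le (P B - P A) (∫ l in A..B, Q l)
  have t2 := norm_sub_le (P B) (P A)
  have t3 := hPn A hAm
  have t4 := hPn B hBm
  linarith [hA'.1, hA'.2, hB'.1, hB'.2]

/-- The truncated oscillatory integral `∫_A^B l^{-1/2} e^{i(al + bl²)} dl`. -/
noncomputable def oscKernel (a b A B : ℝ) : ℂ :=
  ∫ l in A..B, (((√l)⁻¹ : ℝ) : ℂ) * Complex.exp (Complex.I * ((a * l + b * l ^ 2 : ℝ) : ℂ))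

theorem oscKernel_self (a b A : ℝ) : oscKernel a b A A = 0 := intervalIntegral.integral_same

theorem continuousOn_oscKernel_integrand (a b : ℝ) : ContinuousOn (fun l : ℝ =>
    (((√l)⁻¹ : ℝ) : ℂ) * Complex.exp (Complex.I * ((a * l + b * l ^ 2 : ℝ) : ℂ))) (Ioi 0) := by
  have h1 : ContinuousOn (fun l : ℝ => (√l)⁻¹) (Ioi 0) :=
    Real.continuous_sqrt.continuousOn.inv₀ fun l hl => (Real.sqrt_pos.2 hl).ne'
  have h2 : Continuous fun l : ℝ =>
    Complex.exp (Complex.I * ((a * l + b * l ^ 2 : ℝ) : ℂ)) := by fun_prop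
  exact (Complex.continuous_ofReal.comp_continuousOn h1).mul h2.continuousOn

theorem oscKernel_add (a b : ℝ) {A p B : ℝ} (hA : 0 < A) (h1 : A ≤ p) (h2 : p ≤ B) :
    oscKernel a b A p + oscKernel a b p B = oscKernel a b A B := by
  have hi : ∀ x y : ℝ, 0 < x → x ≤ y → IntervalIntegrable (fun l : ℝ =>
      (((√l)⁻¹ : ℝ) : ℂ) * Complex.exp (Complex.I * ((a * l + b * l ^ 2 : ℝ) : ℂ))) volume x y := by
    intro x y hx hxy
    apply ContinuousOn.intervalIntegrable
    rw [uIcc_of_le hxy]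
    exact (continuousOn_oscKernel_integrand a b).mono fun l hl => hx.trans_le hl.1
  exact intervalIntegral.integral_add_adjacent_intervals (hi A p hA h1) (hi p B (hA.trans_le h1) h2)

theorem norm_oscKernel_integrand (a b l : ℝ) :
    ‖(((√l)⁻¹ : ℝ) : ℂ) * Complex.exp (Complex.I * ((a * l + b * l ^ 2 : ℝ) : ℂ))‖ = (√l)⁻¹ := by
  rw [norm_mul, mul_comm Complex.I, Complex.norm_exp_ofReal_mul_I, mul_one, Complex.norm_real,
    Real.norm_of_nonneg (by positivity)]

theorem norm_oscKernel_le_mul_sub (a b : ℝ) {A B : ℝ} (hA : 0 < A) (hAB : A ≤ B) :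
    ‖oscKernel a b A B‖ ≤ (√A)⁻¹ * (B - A) := by
  have := intervalIntegral.norm_integral_le_of_norm_le_const (a := A) (b := B) (C := (√A)⁻¹)
    (f := fun l : ℝ => (((√l)⁻¹ : ℝ) : ℂ) *
      Complex.exp (Complex.I * ((a * l + b * l ^ 2 : ℝ) : ℂ))) (fun l hl => by
      rw [uIoc_of_le hAB] at hl
      rw [norm_oscKernel_integrand]
      exact inv_anti₀ (Real.sqrt_pos.2 hA) (Real.sqrt_le_sqrt hl.1.le))
  rwa [abs_of_nonneg (by linarith)] at this

theorem norm_oscKernel_le_two_mul_sqrt (a b : ℝ) {A B : ℝ} (hA : 0 < A) (hAB : A ≤ B) :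
    ‖oscKernel a b A B‖ ≤ 2 * √B := by
  have hd : ∀ l ∈ uIcc A B, HasDerivAt (fun l => 2 * √l) (√l)⁻¹ l := by
    intro l hl
    rw [uIcc_of_le hAB] at hl
    have hl0 : l ≠ 0 := (hA.trans_le hl.1).ne'
    refine ((Real.hasDerivAt_sqrt hl0).const_mul 2).congr_deriv ?_
    field_simp
  have hi : IntervalIntegrable (fun l => (√l)⁻¹) volume A B := by
    apply ContinuousOn.intervalIntegrable
    rw [uIcc_of_le hAB]
    exact Real.continuous_sqrt.continuousOn.inv₀ fun l hl =>
      (Real.sqrt_pos.2 (hA.trans_le hl.1)).ne'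
  have h := intervalIntegral.norm_integral_le_of_norm_le (a := A) (b := B) (μ := volume) hAB
    (f := fun l : ℝ => (((√l)⁻¹ : ℝ) : ℂ) *
      Complex.exp (Complex.I * ((a * l + b * l ^ 2 : ℝ) : ℂ)))
    (Filter.Eventually.of_forall fun l _ => (norm_oscKernel_integrand a b l).le) hi
  rw [intervalIntegral.integral_eq_sub_of_hasDerivAt hd hi] at h
  have := Real.sqrt_nonneg A
  exact h.trans (by linarith)

theorem norm_oscKernel_le_of_le_abs_deriv {a b A B m : ℝ} (hA : 0 < A) (hAB : A ≤ B) (hm : 0 < m)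
    (hφ : ∀ l ∈ Icc A B, m ≤ |a + 2 * b * l|) :
    ‖oscKernel a b A B‖ ≤ 5 * (√A)⁻¹ / m := by
  have hpos : ∀ l ∈ Icc A B, 0 < l := fun l hl => hA.trans_le hl.1
  refine norm_integral_quadratic_phase_le_of_le_abs_deriv (w := fun l => (√l)⁻¹)
    (w' := fun l => -(1 / (2 * √l)) / √l ^ 2) hAB hm ?_ ?_ ?_ ?_ hφ
  · intro l hl
    exact (Real.hasDerivAt_sqrt (hpos l hl).ne').fun_inv (Real.sqrt_pos.2 (hpos l hl)).ne'
  · have hs : ContinuousOn Real.sqrt (Icc A B) := Real.continuous_sqrt.continuousOn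
    refine ((continuousOn_const.div (continuousOn_const.mul hs) fun l hl => ?_).neg).div
      (hs.pow 2) fun l hl => ?_
    · exact (mul_pos two_pos (Real.sqrt_pos.2 (hpos l hl))).ne'
    · exact (pow_pos (Real.sqrt_pos.2 (hpos l hl)) 2).ne'
  · intro l hl
    rw [neg_div]
    have : 0 ≤ 1 / (2 * √l) / √l ^ 2 := by positivity
    linarith
  · intro l hl
    positivity

/-- Any threshold `L` splits `[A, B]` into a part below `L` and a part above `L`, either of which
may be degenerate. -/
theorem exists_split {A B : ℝ} (hAB : A ≤ B) (L : ℝ) :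
    ∃ p, A ≤ p ∧ p ≤ B ∧ (A < p → p ≤ L) ∧ (p < B → L ≤ p) := by
  rcases le_total L A with h | h
  · exact ⟨A, le_rfl, hAB, fun h' => absurd h' (lt_irrefl _), fun _ => h⟩
  · rcases le_total L B with h' | h'
    · exact ⟨L, h, h', fun _ => le_rfl, fun _ => le_rfl⟩
    · exact ⟨B, hAB, le_rfl, fun _ => h', fun h'' => absurd h'' (lt_irrefl _)⟩

/-- A bound for a possibly degenerate piece need only be checked when the piece is nontrivial. -/
theorem norm_oscKernel_le_of_lt {a b A B c : ℝ} (hAB : A ≤ B) (hc : 0 ≤ c)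
    (h : A < B → ‖oscKernel a b A B‖ ≤ c) : ‖oscKernel a b A B‖ ≤ c := by
  rcases hAB.eq_or_lt with rfl | hlt
  · rwa [oscKernel_self, norm_zero]
  · exact h hlt

/-- Second derivative test. -/
theorem norm_oscKernel_le_div_sqrt {a b A B : ℝ} (hA : 0 < A) (hAB : A ≤ B) (hb : b ≠ 0) :
    ‖oscKernel a b A B‖ ≤ 11 * ((√A)⁻¹ / √|b|) := by
  have hb' : 0 < |b| := abs_pos.2 hb
  set m := √|b| with hmdef
  have hm : 0 < m := Real.sqrt_pos.2 hb'
  have hmm : m * m = |b| := Real.mul_self_sqrt hb'.le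
  set c := -a / (2 * b) with hc
  have hφ : ∀ l, |a + 2 * b * l| = 2 * |b| * |l - c| := by
    intro l
    have : a + 2 * b * l = 2 * b * (l - c) := by rw [hc]; field_simp; ring
    rw [this, abs_mul, abs_mul, abs_two]
  -- the phase derivative is smaller than `m` only within distance `r` of the critical point `c`
  set r := m / (2 * |b|) with hr
  have hr2 : 2 * |b| * r = m := by rw [hr]; field_simp
  have hr3 : 2 * r = 1 / m := by rw [hr, ← hmm]; field_simp
  have hwA : 0 < (√A)⁻¹ := inv_pos.2 (Real.sqrt_pos.2 hA)
  have hwp : ∀ p, A ≤ p → (√p)⁻¹ ≤ (√A)⁻¹ := fun p hp =>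
    inv_anti₀ (Real.sqrt_pos.2 hA) (Real.sqrt_le_sqrt hp)
  obtain ⟨p, hAp, hpB, hp1, hp2⟩ := exists_split hAB (c - r)
  obtain ⟨q, hpq, hqB, hq1, hq2⟩ := exists_split hpB (c + r)
  have h1 : ‖oscKernel a b A p‖ ≤ 5 * (√A)⁻¹ / m := by
    refine norm_oscKernel_le_of_lt hAp (by positivity) fun hlt =>
      norm_oscKernel_le_of_le_abs_deriv hA hAp hm fun l hl => ?_
    rw [hφ, ← hr2]
    gcongr
    rw [abs_sub_comm]
    exact le_trans (by linarith [hp1 hlt, hl.2]) (le_abs_self _)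
  have h2 : ‖oscKernel a b p q‖ ≤ (√A)⁻¹ / m := by
    refine norm_oscKernel_le_of_lt hpq (by positivity) fun hlt => ?_
    refine (norm_oscKernel_le_mul_sub a b (hA.trans_le hAp) hpq).trans ?_
    rw [div_eq_mul_one_div (√A)⁻¹, ← hr3]
    have := hq1 hlt
    have := hp2 (hlt.trans_le hqB)
    exact mul_le_mul (hwp p hAp) (by linarith) (by linarith) hwA.le
  have h3 : ‖oscKernel a b q B‖ ≤ 5 * (√A)⁻¹ / m := by
    refine norm_oscKernel_le_of_lt hqB (by positivity) fun hlt => ?_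
    refine (norm_oscKernel_le_of_le_abs_deriv (hA.trans_le (hAp.trans hpq)) hqB hm
      fun l hl => ?_).trans ?_
    · rw [hφ, ← hr2]
      gcongr
      exact le_trans (by linarith [hq2 hlt, hl.1]) (le_abs_self _)
    · have := hwp q (hAp.trans hpq)
      gcongr
  rw [← oscKernel_add a b hA hAp hpB, ← oscKernel_add a b (hA.trans_le hAp) hpq hqB]
  have e1 := norm_add_le (oscKernel a b A p) (oscKernel a b p q + oscKernel a b q B)
  have e2 := norm_add_le (oscKernel a b p q) (oscKernel a b q B)
  have e3 : 5 * (√A)⁻¹ / m = 5 * ((√A)⁻¹ / m) := by ring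
  linarith

/-- The kernel is `O(|b|^{-1/4})`, uniformly in the linear part of the phase and the truncation. -/
theorem norm_oscKernel_le_quadratic {a b A B : ℝ} (hA : 0 < A) (hAB : A ≤ B) (hb : b ≠ 0) :
    ‖oscKernel a b A B‖ ≤ 13 * (√√|b|)⁻¹ := by
  have hb' : 0 < |b| := abs_pos.2 hb
  set m := √√|b| with hmdef
  have hsb : 0 < √|b| := Real.sqrt_pos.2 hb'
  have hm : 0 < m := Real.sqrt_pos.2 hsb
  have hmm : m * m = √|b| := Real.mul_self_sqrt hsb.le
  have hsq : √((√|b|)⁻¹) = m⁻¹ := Real.sqrt_inv _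
  obtain ⟨p, hAp, hpB, hp1, hp2⟩ := exists_split hAB (√|b|)⁻¹
  have h1 : ‖oscKernel a b A p‖ ≤ 2 * m⁻¹ := by
    refine norm_oscKernel_le_of_lt hAp (by positivity) fun hlt =>
      (norm_oscKernel_le_two_mul_sqrt a b hA hAp).trans ?_
    rw [← hsq]
    have := hp1 hlt
    gcongr
  have h2 : ‖oscKernel a b p B‖ ≤ 11 * m⁻¹ := by
    refine norm_oscKernel_le_of_lt hpB (by positivity) fun hlt =>
      (norm_oscKernel_le_div_sqrt (hA.trans_le hAp) hpB hb).trans ?_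
    have h3 : m⁻¹ ≤ √p := by rw [← hsq]; exact Real.sqrt_le_sqrt (hp2 hlt)
    have h4 : (√p)⁻¹ ≤ m := by simpa using inv_anti₀ (inv_pos.2 hm) h3
    have h5 : m / √|b| = m⁻¹ := by rw [← hmm]; field_simp
    rw [← h5]
    gcongr
  rw [← oscKernel_add a b hA hAp hpB]
  have e1 := norm_add_le (oscKernel a b A p) (oscKernel a b p B)
  linarith

/-- The kernel is `O(|a|^{-1/2})`, uniformly in the quadratic part of the phase and the
truncation. -/
theorem norm_oscKernel_le_linear {a b A B : ℝ} (hA : 0 < A) (hAB : A ≤ B) (ha : a ≠ 0) :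
    ‖oscKernel a b A B‖ ≤ 34 * (√|a|)⁻¹ := by
  have ha' : 0 < |a| := abs_pos.2 ha
  set m := √|a| with hmdef
  have hm : 0 < m := Real.sqrt_pos.2 ha'
  have hmm : m * m = |a| := Real.mul_self_sqrt ha'.le
  have hsq : √(|a|⁻¹) = m⁻¹ := Real.sqrt_inv _
  obtain ⟨p, hAp, hpB, hp1, hp2⟩ := exists_split hAB |a|⁻¹
  have hp0 : 0 < p := hA.trans_le hAp
  have h1 : ‖oscKernel a b A p‖ ≤ 2 * m⁻¹ := by
    refine norm_oscKernel_le_of_lt hAp (by positivity) fun hlt =>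
      (norm_oscKernel_le_two_mul_sqrt a b hA hAp).trans ?_
    rw [← hsq]
    have := hp1 hlt
    gcongr
  -- below `|a| / (4|b|)` the linear part of the phase dominates
  obtain ⟨q, hpq, hqB, hq1, hq2⟩ : ∃ q, p ≤ q ∧ q ≤ B ∧ (p < q → 4 * |b| * q ≤ |a|) ∧
      (q < B → b ≠ 0 ∧ |a| ≤ 4 * |b| * q) := by
    by_cases hb : b = 0
    · exact ⟨B, hpB, le_rfl, fun _ => by rw [hb]; simp, fun h => absurd h (lt_irrefl _)⟩
    · have hb' : 0 < 4 * |b| := by have := abs_pos.2 hb; positivity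
      obtain ⟨q, h1, h2, h3, h4⟩ := exists_split hpB (|a| / (4 * |b|))
      refine ⟨q, h1, h2, fun h => ?_, fun h => ⟨hb, ?_⟩⟩
      · have := h3 h
        rwa [le_div_iff₀ hb', mul_comm] at this
      · have := h4 h
        rwa [div_le_iff₀ hb', mul_comm] at this
  have h2 : ‖oscKernel a b p q‖ ≤ 10 * m⁻¹ := by
    refine norm_oscKernel_le_of_lt hpq (by positivity) fun hlt =>
      (norm_oscKernel_le_of_le_abs_deriv hp0 hpq (m := |a| / 2) (by positivity)
        fun l hl => ?_).trans ?_
    · have e1 : |2 * b * l| ≤ |a| / 2 := by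
        rw [abs_mul, abs_mul, abs_two, abs_of_pos (hp0.trans_le hl.1)]
        have := mul_le_mul_of_nonneg_left hl.2 (abs_nonneg b)
        linarith [hq1 hlt]
      have e2 := abs_sub_abs_le_abs_sub a (-(2 * b * l))
      rw [abs_neg, sub_neg_eq_add] at e2
      linarith
    · have h3 : m⁻¹ ≤ √p := by rw [← hsq]; exact Real.sqrt_le_sqrt (hp2 (hlt.trans_le hqB))
      have h4 : (√p)⁻¹ ≤ m := by simpa using inv_anti₀ (inv_pos.2 hm) h3
      have h5 : 10 * m⁻¹ = 5 * m / (|a| / 2) := by rw [← hmm]; field_simp; norm_num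
      rw [h5]
      gcongr
  have h3 : ‖oscKernel a b q B‖ ≤ 22 * m⁻¹ := by
    have hq0 : 0 < q := hp0.trans_le hpq
    refine norm_oscKernel_le_of_lt hqB (by positivity) fun hlt =>
      (norm_oscKernel_le_div_sqrt hq0 hqB (hq2 hlt).1).trans ?_
    have e1 : m ≤ 2 * (√|b| * √q) := by
      have := Real.sqrt_le_sqrt (hq2 hlt).2
      rwa [mul_assoc, Real.sqrt_mul (by norm_num), Real.sqrt_mul (abs_nonneg b),
        show (4 : ℝ) = 2 ^ 2 by norm_num, Real.sqrt_sq (by norm_num)] at this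
    have e2 : 0 < √|b| * √q :=
      mul_pos (Real.sqrt_pos.2 (abs_pos.2 (hq2 hlt).1)) (Real.sqrt_pos.2 hq0)
    have e3 : (√q)⁻¹ / √|b| = (√|b| * √q)⁻¹ := by rw [mul_inv, div_eq_mul_inv, mul_comm]
    rw [e3]
    have e4 : (√|b| * √q)⁻¹ ≤ 2 * m⁻¹ := by
      rw [← div_eq_mul_inv, le_div_iff₀ hm, inv_mul_le_iff₀ e2]
      linarith
    linarith
  rw [← oscKernel_add a b hA hAp hpB, ← oscKernel_add a b hp0 hpq hqB]
  have e1 := norm_add_le (oscKernel a b A p) (oscKernel a b p q + oscKernel a b q B)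
  have e2 := norm_add_le (oscKernel a b p q) (oscKernel a b q B)
  linarith

/-! ### The `TT*` method -/

open scoped ComplexConjugate in
/-- The `TT*` method with Schur's test: if the kernel `K(x, x') = ∫ E(x, y) conj E(x', y) dy`
satisfies `∫ |K(x, x')| dx' ≤ M` for almost every `x`, then
`k ↦ ∫ E(x, y) k(y) dy` has norm at most `√M` on `L²`. -/
theorem integral_sq_norm_integral_le {X Y : Type*} [MeasurableSpace X] [MeasurableSpace Y]
    {ν : Measure X} {μ : Measure Y} [IsFiniteMeasure ν] [IsFiniteMeasure μ] {E : X → Y → ℂ}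
    (hE : Measurable (Function.uncurry E)) {D : ℝ} (hD : ∀ x y, ‖E x y‖ ≤ D) {k : Y → ℂ}
    (hk : MemLp k 2 μ) {M : ℝ} (hM0 : 0 < M)
    (hM : ∀ᵐ x ∂ν, ∫ x', ‖∫ y, E x y * conj (E x' y) ∂μ‖ ∂ν ≤ M) :
    ∫ x, ‖∫ y, E x y * k y ∂μ‖ ^ 2 ∂ν ≤ M * ∫ y, ‖k y‖ ^ 2 ∂μ := by
  rcases isEmpty_or_nonempty X with hX | ⟨⟨x₀⟩⟩
  · rw [Measure.eq_zero_of_isEmpty ν, integral_zero_measure]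
    exact mul_nonneg hM0.le (integral_nonneg fun _ => by positivity)
  rcases isEmpty_or_nonempty Y with hY | ⟨⟨y₀⟩⟩
  · rw [Measure.eq_zero_of_isEmpty μ]
    simp
  have hD0 : 0 ≤ D := (norm_nonneg _).trans (hD x₀ y₀)
  have hk1 : Integrable k μ := hk.integrable (by norm_num)
  have hk2 : Integrable (fun y => ‖k y‖ ^ 2) μ := hk.integrable_norm_pow (by norm_num)
  have hEx : ∀ x, Measurable (E x) := fun x => hE.comp measurable_prodMk_left
  set F : X → ℂ := fun x => ∫ y, E x y * k y ∂μ with hF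
  set N := ∫ y, ‖k y‖ ∂μ
  have hFb : ∀ x, ‖F x‖ ≤ D * N := by
    intro x
    rw [← integral_const_mul]
    refine norm_integral_le_of_norm_le (hk1.norm.const_mul D) (Filter.Eventually.of_forall ?_)
    intro y
    rw [norm_mul]
    gcongr
    exact hD x y
  have hFm : AEStronglyMeasurable F ν := by
    have : AEStronglyMeasurable (fun z : X × Y => E z.1 z.2 * k z.2) (ν.prod μ) :=
      hE.aestronglyMeasurable.mul hk.aestronglyMeasurable.comp_snd
    exact this.integral_prod_right'
  have hFi : Integrable F ν := Integrable.of_bound hFm (D * N) (.of_forall hFb)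
  have hF2 : Integrable (fun x => ‖F x‖ ^ 2) ν :=
    Integrable.of_bound (hFm.norm.pow 2) ((D * N) ^ 2) (.of_forall fun x => by
      rw [Real.norm_of_nonneg (by positivity)]
      gcongr
      exact hFb x)
  have hFc : Integrable (fun x => conj (F x)) ν :=
    Integrable.of_bound (Complex.continuous_conj.comp_aestronglyMeasurable hFm) (D * N)
      (.of_forall fun x => by rw [RCLike.norm_conj]; exact hFb x)
  -- up to complex conjugation, `G` is the adjoint operator applied to `F`
  set G : Y → ℂ := fun y => ∫ x, E x y * conj (F x) ∂ν with hG
  set N' := ∫ x, ‖conj (F x)‖ ∂ν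
  have hGb : ∀ y, ‖G y‖ ≤ D * N' := by
    intro y
    rw [← integral_const_mul]
    refine norm_integral_le_of_norm_le (hFc.norm.const_mul D) (Filter.Eventually.of_forall ?_)
    intro x
    rw [norm_mul]
    gcongr
    exact hD x y
  have hGm : AEStronglyMeasurable G μ := by
    have : AEStronglyMeasurable (fun z : Y × X => E z.2 z.1 * conj (F z.2)) (μ.prod ν) :=
      (hE.comp measurable_swap).aestronglyMeasurable.mul hFc.aestronglyMeasurable.comp_snd
    exact this.integral_prod_right'
  have hG2 : Integrable (fun x => ‖G x‖ ^ 2) μ :=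
    Integrable.of_bound (hGm.norm.pow 2) ((D * N') ^ 2) (.of_forall fun x => by
      rw [Real.norm_of_nonneg (by positivity)]
      gcongr
      exact hGb x)
  have hGc : Integrable (fun y => conj (G y)) μ :=
    Integrable.of_bound (Complex.continuous_conj.comp_aestronglyMeasurable hGm) (D * N')
      (.of_forall fun x => by rw [RCLike.norm_conj]; exact hGb x)
  -- `‖F‖² = ⟨k, G⟩`
  have hstar : ∀ (u : X → ℂ) (v : Y → ℂ), Integrable u ν → Integrable v μ →
      ∫ x, u x * ∫ y, E x y * v y ∂μ ∂ν = ∫ y, v y * ∫ x, E x y * u x ∂ν ∂μ := by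
    intro u v hu hv
    have hint : Integrable (Function.uncurry fun x y => u x * (E x y * v y)) (ν.prod μ) := by
      have := (hu.mul_prod hv).bdd_mul (c := D) (f := Function.uncurry E) hE.aestronglyMeasurable
        (.of_forall fun z => hD z.1 z.2)
      refine this.congr (.of_forall fun z => ?_)
      simp only [Function.uncurry]
      ring
    have := integral_integral_swap hint
    simp only [← integral_const_mul]
    rw [this]
    congr 1; ext y; congr 1; ext x; ring
  have hFG : ∫ x, ‖F x‖ ^ 2 ∂ν ≤ ∫ y, ‖k y‖ * ‖G y‖ ∂μ := by
    have h1 := hstar (fun x => conj (F x)) k hFc hk1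
    have h2 : ∫ x, conj (F x) * ∫ y, E x y * k y ∂μ ∂ν = ((∫ x, ‖F x‖ ^ 2 ∂ν : ℝ) : ℂ) := by
      rw [← integral_complex_ofReal]
      congr 1; ext x
      rw [mul_comm, Complex.mul_conj, Complex.normSq_eq_norm_sq]
    rw [h2] at h1
    have h3 : ‖((∫ x, ‖F x‖ ^ 2 ∂ν : ℝ) : ℂ)‖ = ∫ x, ‖F x‖ ^ 2 ∂ν := by
      rw [Complex.norm_real, Real.norm_of_nonneg (integral_nonneg fun _ => by positivity)]
    rw [← h3, h1]
    refine (norm_integral_le_integral_norm _).trans (le_of_eq ?_)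
    congr 1; ext y; rw [norm_mul]
  -- `‖G‖² ≤ M ‖F‖²`
  set K : X → X → ℂ := fun x x' => ∫ y, E x y * conj (E x' y) ∂μ with hK
  have hKsym : ∀ x x', ‖K x x'‖ = ‖K x' x‖ := by
    intro x x'
    rw [← RCLike.norm_conj, ← integral_conj]
    congr 2; ext y; simp [mul_comm]
  have hKm : StronglyMeasurable (Function.uncurry K) := by
    have : StronglyMeasurable (fun z : (X × X) × Y => E z.1.1 z.2 * conj (E z.1.2 z.2)) := by
      apply Measurable.stronglyMeasurable
      exact (hE.comp ((measurable_fst.comp measurable_fst).prodMk measurable_snd)).mul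
        (Complex.continuous_conj.measurable.comp
          (hE.comp ((measurable_snd.comp measurable_fst).prodMk measurable_snd)))
    exact this.integral_prod_right'
  set D' := D * D * μ.real univ
  have hKb : ∀ x x', ‖K x x'‖ ≤ D' := by
    intro x x'
    refine norm_integral_le_of_norm_le_const (.of_forall fun y => ?_)
    rw [norm_mul, RCLike.norm_conj]
    exact mul_le_mul (hD x y) (hD x' y) (norm_nonneg _) hD0
  have hH : ∀ x, ∫ y, E x y * conj (G y) ∂μ = ∫ x', K x x' * F x' ∂ν := by
    intro x
    have h1 : ∀ y, conj (G y) = ∫ x', conj (E x' y) * F x' ∂ν := by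
      intro y
      rw [← integral_conj]
      congr 1; ext x'; simp
    simp only [h1, ← integral_const_mul]
    rw [integral_integral_swap]
    · congr 1; ext x'
      rw [hK]
      simp only
      rw [← integral_mul_const]
      congr 1; ext y; ring
    · have := (integrable_const (μ := μ) (1 : ℂ)).mul_prod hFi
      have := this.bdd_mul (c := D * D) (f := fun z : Y × X => E x z.1 * conj (E z.2 z.1))
        (((hEx x).comp measurable_fst).mul (Complex.continuous_conj.measurable.comp
          (hE.comp measurable_swap))).aestronglyMeasurable (.of_forall fun z => by
            rw [norm_mul, RCLike.norm_conj]
            exact mul_le_mul (hD _ _) (hD _ _) (norm_nonneg _) hD0)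
      refine this.congr (.of_forall fun z => ?_)
      simp only [Function.uncurry]
      ring
  have hKint : ∀ x, Integrable (fun x' => ‖K x x'‖) ν := fun x =>
    Integrable.of_bound (hKm.comp_measurable measurable_prodMk_left).norm.aestronglyMeasurable D'
      (.of_forall fun x' => by rw [norm_norm]; exact hKb x x')
  have hW : Integrable (Function.uncurry fun x x' => ‖K x x'‖ * ‖F x‖ ^ 2) (ν.prod ν) := by
    have := (hF2.mul_prod (integrable_const (μ := ν) (1 : ℝ))).bdd_mul (c := D')
      (f := fun z : X × X => ‖K z.1 z.2‖) hKm.norm.aestronglyMeasurable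
      (.of_forall fun z => by rw [norm_norm]; exact hKb _ _)
    refine this.congr (.of_forall fun z => ?_)
    simp [Function.uncurry]
  have hW' : Integrable (Function.uncurry fun x x' => ‖K x x'‖ * ‖F x'‖ ^ 2) (ν.prod ν) := by
    refine hW.swap.congr (.of_forall fun z => ?_)
    simp only [Function.comp, Function.uncurry, Prod.fst_swap, Prod.snd_swap]
    rw [hKsym]
  have hWle : ∫ x, ∫ x', ‖K x x'‖ * ‖F x‖ ^ 2 ∂ν ∂ν ≤ M * ∫ x, ‖F x‖ ^ 2 ∂ν := by
    rw [← integral_const_mul]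
    refine integral_mono_ae hW.integral_prod_left (hF2.const_mul M) ?_
    filter_upwards [hM] with x hx
    rw [integral_mul_const]
    gcongr
  have hWeq : ∫ x, ∫ x', ‖K x x'‖ * ‖F x'‖ ^ 2 ∂ν ∂ν = ∫ x, ∫ x', ‖K x x'‖ * ‖F x‖ ^ 2 ∂ν ∂ν := by
    rw [integral_integral_swap hW']
    congr 1; ext x; congr 1; ext x'; rw [hKsym]
  have hGF : ∫ y, ‖G y‖ ^ 2 ∂μ ≤ M * ∫ x, ‖F x‖ ^ 2 ∂ν := by
    have h1 := hstar (fun x => conj (F x)) (fun y => conj (G y)) hFc hGc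
    have h2 : ∫ y, conj (G y) * ∫ x, E x y * conj (F x) ∂ν ∂μ = ((∫ y, ‖G y‖ ^ 2 ∂μ : ℝ) : ℂ) := by
      rw [← integral_complex_ofReal]
      congr 1; ext x
      rw [mul_comm, Complex.mul_conj, Complex.normSq_eq_norm_sq]
    rw [h2] at h1
    have h3 : ‖((∫ x, ‖G x‖ ^ 2 ∂μ : ℝ) : ℂ)‖ = ∫ x, ‖G x‖ ^ 2 ∂μ := by
      rw [Complex.norm_real, Real.norm_of_nonneg (integral_nonneg fun _ => by positivity)]
    rw [← h3, ← h1]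
    simp only [hH]
    calc ‖∫ x, conj (F x) * ∫ x', K x x' * F x' ∂ν ∂ν‖
        ≤ ∫ x, ((∫ x', ‖K x x'‖ * ‖F x‖ ^ 2 ∂ν) + ∫ x', ‖K x x'‖ * ‖F x'‖ ^ 2 ∂ν) / 2 ∂ν := by
          refine norm_integral_le_of_norm_le
            ((hW.integral_prod_left.add hW'.integral_prod_left).div_const 2)
            (.of_forall fun x => ?_)
          have i1 : Integrable (fun x' => ‖K x x'‖ * ‖F x‖ ^ 2) ν := (hKint x).mul_const _
          have i2 : Integrable (fun x' => ‖K x x'‖ * ‖F x'‖ ^ 2) ν := by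
            refine hF2.bdd_mul (c := D') (hKint x).aestronglyMeasurable (.of_forall fun x' => ?_)
            rw [norm_norm]; exact hKb x x'
          rw [← integral_add i1 i2, ← integral_div, ← integral_const_mul]
          refine norm_integral_le_of_norm_le ((i1.add i2).div_const 2) (.of_forall fun x' => ?_)
          rw [norm_mul, norm_mul, RCLike.norm_conj]
          have := mul_nonneg (norm_nonneg (K x x')) (sq_nonneg (‖F x‖ - ‖F x'‖))
          change _ ≤ (‖K x x'‖ * ‖F x‖ ^ 2 + ‖K x x'‖ * ‖F x'‖ ^ 2) / 2
          linarith
      _ = ∫ x, ∫ x', ‖K x x'‖ * ‖F x‖ ^ 2 ∂ν ∂ν := by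
          have e : ∫ x, ((∫ x', ‖K x x'‖ * ‖F x‖ ^ 2 ∂ν) + ∫ x', ‖K x x'‖ * ‖F x'‖ ^ 2 ∂ν) ∂ν =
              (∫ x, ∫ x', ‖K x x'‖ * ‖F x‖ ^ 2 ∂ν ∂ν) + ∫ x, ∫ x', ‖K x x'‖ * ‖F x'‖ ^ 2 ∂ν ∂ν :=
            integral_add hW.integral_prod_left hW'.integral_prod_left
          rw [integral_div, e, hWeq]
          ring
      _ ≤ _ := hWle
  have hAMGM : ∫ y, ‖k y‖ * ‖G y‖ ∂μ ≤ (M * ∫ y, ‖k y‖ ^ 2 ∂μ + M⁻¹ * ∫ y, ‖G y‖ ^ 2 ∂μ) / 2 := by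
    rw [← integral_const_mul, ← integral_const_mul, ← integral_add (hk2.const_mul M)
      (hG2.const_mul M⁻¹), ← integral_div]
    refine integral_mono_of_nonneg (.of_forall fun y => by positivity)
      (((hk2.const_mul M).add (hG2.const_mul M⁻¹)).div_const 2) (.of_forall fun y => ?_)
    have h1 := mul_nonneg (inv_pos.2 hM0).le (sq_nonneg (M * ‖k y‖ - ‖G y‖))
    have h2 : M⁻¹ * (M * ‖k y‖ - ‖G y‖) ^ 2 = M * ‖k y‖ ^ 2 + M⁻¹ * ‖G y‖ ^ 2
        - 2 * (‖k y‖ * ‖G y‖) := by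
      field_simp
      ring
    simp only
    linarith
  have h4 : M⁻¹ * ∫ y, ‖G y‖ ^ 2 ∂μ ≤ ∫ x, ‖F x‖ ^ 2 ∂ν := by
    rwa [inv_mul_le_iff₀ hM0]
  linarith

/-! ### The maximal estimate in dimension one -/

theorem intervalIntegral_inv_sqrt {x : ℝ} (hx : 0 ≤ x) :
    IntervalIntegrable (fun u : ℝ => (√|u|)⁻¹) volume 0 x ∧
      ∫ u in (0 : ℝ)..x, (√|u|)⁻¹ = 2 * √x := by
  have hcongr : ∀ u ∈ uIoc 0 x, u ^ (-(1 / 2) : ℝ) = (√|u|)⁻¹ := by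
    intro u hu
    rw [uIoc_of_le hx] at hu
    rw [abs_of_pos hu.1, Real.rpow_neg hu.1.le, Real.sqrt_eq_rpow]
  constructor
  · exact (intervalIntegral.intervalIntegrable_rpow' (a := 0) (b := x) (r := -(1 / 2))
      (by norm_num)).congr hcongr
  · rw [← intervalIntegral.integral_congr_ae (.of_forall hcongr),
      integral_rpow (Or.inl (by norm_num)), Real.zero_rpow (by norm_num), Real.sqrt_eq_rpow]
    norm_num
    ring

theorem integrableOn_inv_sqrt_abs_sub {δ₁ δ₂ s : ℝ} (hs : s ∈ Ioo δ₁ δ₂) :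
    IntegrableOn (fun s' : ℝ => (√|s - s'|)⁻¹) (Ioo δ₁ δ₂) ∧
      ∫ s' in Ioo δ₁ δ₂, (√|s - s'|)⁻¹ ≤ 4 * √(δ₂ - δ₁) := by
  have hle : δ₁ ≤ δ₂ := (hs.1.trans hs.2).le
  obtain ⟨i1, e1⟩ := intervalIntegral_inv_sqrt (x := s - δ₁) (by linarith [hs.1])
  obtain ⟨i2, e2⟩ := intervalIntegral_inv_sqrt (x := δ₂ - s) (by linarith [hs.2])
  have j1 : IntervalIntegrable (fun s' : ℝ => (√|s - s'|)⁻¹) volume δ₁ s := by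
    have := (i1.comp_sub_left s).symm
    simpa using this
  have j2 : IntervalIntegrable (fun s' : ℝ => (√|s - s'|)⁻¹) volume s δ₂ := by
    have := i2.comp_sub_right s
    simpa [abs_sub_comm] using this
  have f1 : ∫ s' in δ₁..s, (√|s - s'|)⁻¹ = 2 * √(s - δ₁) := by
    rw [← e1, intervalIntegral.integral_comp_sub_left (fun u => (√|u|)⁻¹) s, sub_self]
  have f2 : ∫ s' in s..δ₂, (√|s - s'|)⁻¹ = 2 * √(δ₂ - s) := by
    simp_rw [abs_sub_comm s]
    rw [← e2, intervalIntegral.integral_comp_sub_right (fun u => (√|u|)⁻¹) s, sub_self]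
  constructor
  · have := (j1.trans j2).1
    exact this.mono_set Ioo_subset_Ioc_self
  · rw [← integral_Ioc_eq_integral_Ioo, ← intervalIntegral.integral_of_le hle,
      ← intervalIntegral.integral_add_adjacent_intervals j1 j2, f1, f2]
    have h1 : √(s - δ₁) ≤ √(δ₂ - δ₁) := Real.sqrt_le_sqrt (by linarith [hs.2])
    have h2 : √(δ₂ - s) ≤ √(δ₂ - δ₁) := Real.sqrt_le_sqrt (by linarith [hs.1])
    linarith

theorem lintegral_enorm_sq_eq_ofReal {α : Type*} [MeasurableSpace α] {μ : Measure α} {f : α → ℂ}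
    (hf : Integrable (fun x => ‖f x‖ ^ 2) μ) :
    ∫⁻ x, ‖f x‖ₑ ^ 2 ∂μ = ENNReal.ofReal (∫ x, ‖f x‖ ^ 2 ∂μ) := by
  rw [ofReal_integral_eq_lintegral_ofReal hf (.of_forall fun _ => by positivity)]
  congr 1; ext x
  rw [ENNReal.ofReal_pow (norm_nonneg _), ofReal_norm]

theorem memLp_two_of_lintegral_lt_top {α : Type*} [MeasurableSpace α] {μ : Measure α} {f : α → ℂ}
    (hf : AEStronglyMeasurable f μ) (h : ∫⁻ x, ‖f x‖ₑ ^ 2 ∂μ < ∞) : MemLp f 2 μ := by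
  refine ⟨hf, ?_⟩
  rw [eLpNorm_lt_top_iff_lintegral_rpow_enorm_lt_top (by norm_num) (by norm_num)]
  simpa using h

/-- The frequency-truncated one-dimensional Schrödinger evolution
`∫_A^B e^{i(al + bl²)} h(l) dl` at position `a` and time `b`. -/
noncomputable def truncatedEvolution (h : ℝ → ℂ) (A B a b : ℝ) : ℂ :=
  ∫ l in Ioc A B, Complex.exp (Complex.I * ((a * l + b * l ^ 2 : ℝ) : ℂ)) * h l

theorem norm_exp_I_mul_ofReal_eq_one (x : ℝ) : ‖Complex.exp (Complex.I * (x : ℂ))‖ = 1 := by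
  rw [mul_comm, Complex.norm_exp_ofReal_mul_I]

theorem continuous_truncatedEvolution {h : ℝ → ℂ} {A B : ℝ} (hh : IntegrableOn h (Ioc A B)) :
    Continuous fun z : ℝ × ℝ => truncatedEvolution h A B z.1 z.2 := by
  refine continuous_of_dominated (bound := fun l => ‖h l‖) (fun z => ?_)
    (fun z => .of_forall fun l => ?_) hh.norm (.of_forall fun l => by fun_prop)
  · exact (Continuous.aestronglyMeasurable (by fun_prop)).mul hh.aestronglyMeasurable
  · rw [norm_mul, norm_exp_I_mul_ofReal_eq_one, one_mul]

/-- The weight `l^{1/4}` is bounded below on `(A, B]`, so `h` is integrable there as soon as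
`l^{1/4} h` is square integrable. -/
theorem integrableOn_of_memLp_weight {h : ℝ → ℂ} {A B : ℝ} (hA : 0 < A)
    (hk : MemLp (fun l => ((√√l : ℝ) : ℂ) * h l) 2 (volume.restrict (Ioc A B))) :
    IntegrableOn h (Ioc A B) := by
  have h1 : Integrable (fun l => ((√√l : ℝ) : ℂ) * h l) (volume.restrict (Ioc A B)) :=
    hk.integrable (by norm_num)
  have h2 := h1.bdd_mul (c := (√√A)⁻¹) (f := fun l : ℝ => (((√√l)⁻¹ : ℝ) : ℂ))
    (by fun_prop) ?_
  · refine h2.congr ?_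
    filter_upwards [ae_restrict_mem measurableSet_Ioc] with l hl
    have hl0 : 0 < √√l := Real.sqrt_pos.2 (Real.sqrt_pos.2 (hA.trans hl.1))
    rw [← mul_assoc, ← Complex.ofReal_mul, inv_mul_cancel₀ hl0.ne', Complex.ofReal_one, one_mul]
  · filter_upwards [ae_restrict_mem measurableSet_Ioc] with l hl
    have hA0 : 0 < √√A := Real.sqrt_pos.2 (Real.sqrt_pos.2 hA)
    rw [Complex.norm_real, Real.norm_of_nonneg (by positivity)]
    exact inv_anti₀ hA0 (Real.sqrt_le_sqrt (Real.sqrt_le_sqrt hl.1.le))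

/-- The estimate for the evolution along a measurable choice of position `a s` and time `τ s`. -/
theorem lintegral_truncatedEvolution_sq_le {δ₁ δ₂ A B c : ℝ} (hδ : δ₁ < δ₂) (hA : 0 < A)
    (hAB : A ≤ B) (hc : 0 < c) {a τ : ℝ → ℝ} (ha : Measurable a) (hτ : Measurable τ)
    (hker : ∀ s ∈ Ioo δ₁ δ₂, ∀ s' ∈ Ioo δ₁ δ₂, s ≠ s' →
      ‖oscKernel (a s - a s') (τ s - τ s') A B‖ ≤ c * (√|s - s'|)⁻¹) {h : ℝ → ℂ}
    (hk : MemLp (fun l => ((√√l : ℝ) : ℂ) * h l) 2 (volume.restrict (Ioc A B))) :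
    ∫⁻ s in Ioo δ₁ δ₂, ‖truncatedEvolution h A B (a s) (τ s)‖ₑ ^ 2 ≤
      ENNReal.ofReal (c * (4 * √(δ₂ - δ₁))) *
        ∫⁻ l in Ioc A B, ‖((√√l : ℝ) : ℂ) * h l‖ₑ ^ 2 := by
  have hA0 : 0 < √√A := Real.sqrt_pos.2 (Real.sqrt_pos.2 hA)
  have hh := integrableOn_of_memLp_weight hA hk
  set M := c * (4 * √(δ₂ - δ₁)) with hM
  have hM0 : 0 < M := by
    have := Real.sqrt_pos.2 (sub_pos.2 hδ)
    positivity
  -- the amplitude is frozen below `A` to make it bounded everywhere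
  set E : ℝ → ℝ → ℂ := fun s l => Complex.exp (Complex.I * ((a s * l + τ s * l ^ 2 : ℝ) : ℂ)) *
    (((√√(max l A))⁻¹ : ℝ) : ℂ) with hE
  have hEm : Measurable (Function.uncurry E) := by
    have h1 : Measurable fun z : ℝ × ℝ => a z.1 := ha.comp measurable_fst
    have h2 : Measurable fun z : ℝ × ℝ => τ z.1 := hτ.comp measurable_fst
    simp only [hE, Function.uncurry_def]
    fun_prop
  have hEb : ∀ s l, ‖E s l‖ ≤ (√√A)⁻¹ := by
    intro s l
    simp only [hE]
    rw [norm_mul, norm_exp_I_mul_ofReal_eq_one, one_mul, Complex.norm_real,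
      Real.norm_of_nonneg (by positivity)]
    exact inv_anti₀ hA0 (Real.sqrt_le_sqrt (Real.sqrt_le_sqrt (le_max_right _ _)))
  have hK : ∀ s s', ∫ l in Ioc A B, E s l * (starRingEnd ℂ) (E s' l) =
      oscKernel (a s - a s') (τ s - τ s') A B := by
    intro s s'
    rw [oscKernel, intervalIntegral.integral_of_le hAB]
    refine setIntegral_congr_fun measurableSet_Ioc fun l hl => ?_
    simp only [hE]
    rw [max_eq_left hl.1.le, map_mul, ← Complex.exp_conj, map_mul, Complex.conj_I,
      Complex.conj_ofReal, Complex.conj_ofReal]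
    have e1 : (√l)⁻¹ = (√√l)⁻¹ * (√√l)⁻¹ := by
      rw [← mul_inv, Real.mul_self_sqrt (Real.sqrt_nonneg _)]
    have e2 : Complex.I * (((a s - a s') * l + (τ s - τ s') * l ^ 2 : ℝ) : ℂ) =
        Complex.I * ((a s * l + τ s * l ^ 2 : ℝ) : ℂ) +
          -Complex.I * ((a s' * l + τ s' * l ^ 2 : ℝ) : ℂ) := by
      push_cast; ring
    rw [e1, e2, Complex.exp_add, Complex.ofReal_mul]
    ring
  have hMb : ∀ᵐ s ∂(volume.restrict (Ioo δ₁ δ₂)),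
      ∫ s' in Ioo δ₁ δ₂, ‖∫ l in Ioc A B, E s l * (starRingEnd ℂ) (E s' l)‖ ≤ M := by
    filter_upwards [ae_restrict_mem measurableSet_Ioo] with s hs
    obtain ⟨i1, i2⟩ := integrableOn_inv_sqrt_abs_sub hs
    calc _ ≤ ∫ s' in Ioo δ₁ δ₂, c * (√|s - s'|)⁻¹ := by
          refine integral_mono_of_nonneg (.of_forall fun _ => norm_nonneg _) (i1.const_mul c) ?_
          have hne : ∀ᵐ s' ∂(volume.restrict (Ioo δ₁ δ₂)), s' ≠ s :=
            ae_restrict_of_ae (Measure.ae_ne volume s)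
          filter_upwards [ae_restrict_mem measurableSet_Ioo, hne] with s' hs' hne'
          rw [hK]
          exact hker s hs s' hs' hne'.symm
      _ ≤ M := by
          rw [integral_const_mul, hM]
          gcongr
  have key := integral_sq_norm_integral_le (ν := volume.restrict (Ioo δ₁ δ₂))
    (μ := volume.restrict (Ioc A B)) hEm hEb hk hM0 hMb
  have hEk : ∀ s, ∫ l in Ioc A B, E s l * (((√√l : ℝ) : ℂ) * h l) =
      truncatedEvolution h A B (a s) (τ s) := by
    intro s
    refine setIntegral_congr_fun measurableSet_Ioc fun l hl => ?_
    have hl0 : 0 < √√l := Real.sqrt_pos.2 (Real.sqrt_pos.2 (hA.trans hl.1))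
    have e1 : ((((√√l)⁻¹ : ℝ) : ℂ)) * ((√√l : ℝ) : ℂ) = 1 := by
      rw [← Complex.ofReal_mul, inv_mul_cancel₀ hl0.ne', Complex.ofReal_one]
    simp only [hE]
    rw [max_eq_left hl.1.le]
    linear_combination (Complex.exp (Complex.I * ((a s * l + τ s * l ^ 2 : ℝ) : ℂ)) * h l) * e1
  simp only [hEk] at key
  have hFm : Measurable fun s => truncatedEvolution h A B (a s) (τ s) :=
    (continuous_truncatedEvolution hh).measurable.comp (ha.prodMk hτ)
  have hFi : Integrable (fun s => ‖truncatedEvolution h A B (a s) (τ s)‖ ^ 2)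
      (volume.restrict (Ioo δ₁ δ₂)) := by
    refine Integrable.of_bound (hFm.norm.pow_const 2).aestronglyMeasurable
      ((∫ l in Ioc A B, ‖h l‖) ^ 2) (.of_forall fun s => ?_)
    rw [Real.norm_of_nonneg (by positivity)]
    gcongr
    refine norm_integral_le_of_norm_le hh.norm (.of_forall fun l => ?_)
    rw [norm_mul, norm_exp_I_mul_ofReal_eq_one, one_mul]
  rw [lintegral_enorm_sq_eq_ofReal hFi,
    lintegral_enorm_sq_eq_ofReal (hk.integrable_norm_pow (by norm_num)),
    ← ENNReal.ofReal_mul hM0.le]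
  exact ENNReal.ofReal_le_ofReal key

theorem measurable_eval_selection {X β : Type*} [MeasurableSpace X] [MeasurableSpace β]
    {F : ℕ → X → β} (hF : ∀ n, Measurable (F n)) {i : X → ℕ} (hi : Measurable i) :
    Measurable fun x => F (i x) x :=
  (measurable_from_prod_countable_right (f := fun z : ℕ × X => F z.1 z.2) hF).comp
    (hi.prodMk measurable_id)

theorem exists_measurable_argmax {X : Type*} [MeasurableSpace X] {F : ℕ → X → ℝ≥0∞}
    (hF : ∀ n, Measurable (F n)) (N : ℕ) :
    ∃ i : X → ℕ, Measurable i ∧ (∀ x, i x ≤ N) ∧ ∀ x, ∀ j ≤ N, F j x ≤ F (i x) x := by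
  induction N with
  | zero =>
    exact ⟨fun _ => 0, measurable_const, fun _ => le_rfl, fun x j hj => by
      rw [Nat.le_zero.1 hj]⟩
  | succ N ih =>
    obtain ⟨i, hi, hiN, hmax⟩ := ih
    have hFi : Measurable fun x => F (i x) x :=
      measurable_eval_selection hF hi
    classical
    refine ⟨fun x => if F (i x) x < F (N + 1) x then N + 1 else i x,
      Measurable.ite (measurableSet_lt hFi (hF _)) measurable_const hi, fun x => ?_,
      fun x j hj => ?_⟩
    · dsimp only
      split_ifs
      · exact le_rfl
      · exact (hiN x).trans (Nat.le_succ N)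
    · dsimp only
      rcases Nat.le_succ_iff.1 hj with hj' | rfl
      · split_ifs with hlt
        · exact (hmax x j hj').trans hlt.le
        · exact hmax x j hj'
      · split_ifs with hlt
        · exact le_rfl
        · exact not_lt.1 hlt

/-- Linearization of a maximal function: an `L²` bound along every measurable choice of index
bounds the supremum. -/
theorem lintegral_iSup_sq_le_of_selection {X : Type*} [MeasurableSpace X] {μ : Measure X}
    {G : ℕ → X → ℝ≥0∞} (hG : ∀ n, Measurable (G n)) {C : ℝ≥0∞}
    (h : ∀ i : X → ℕ, Measurable i → ∫⁻ x, (G (i x) x) ^ 2 ∂μ ≤ C) :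
    ∫⁻ x, (⨆ n, G n x) ^ 2 ∂μ ≤ C := by
  choose i hi hiN hmax using exists_measurable_argmax hG
  have hpow : ∀ x, (⨆ n, G n x) ^ 2 = ⨆ N, (G (i N x) x) ^ 2 := by
    intro x
    rw [ENNReal.iSup_pow_of_ne_zero two_ne_zero]
    apply le_antisymm
    · exact iSup_mono fun n => pow_le_pow_left' (hmax n x n le_rfl) 2
    · exact iSup_le fun N => le_iSup (fun n => G n x ^ 2) (i N x)
  have hmono : Monotone fun N x => (G (i N x) x) ^ 2 := fun N N' hN x =>
    pow_le_pow_left' (hmax N' x _ ((hiN N x).trans hN)) 2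
  simp only [hpow]
  rw [lintegral_iSup (fun N => (measurable_eval_selection hG (hi N)).pow_const 2) hmono]
  exact iSup_le fun N => h (i N) (hi N)

/-- The one-dimensional maximal estimate for the truncated evolution: by continuity the supremum
is one over a sequence of times, and over finitely many times it is attained at a measurable
choice. -/
theorem lintegral_iSup_truncatedEvolution_sq_le {δ₁ δ₂ A B c : ℝ} (hδ : δ₁ < δ₂) (hA : 0 < A)
    (hAB : A ≤ B) (hc : 0 < c) {a : ℝ → ℝ → ℝ} {S : Set ℝ} (hS : S.Nonempty)
    (has : ∀ t ∈ S, ContinuousOn (fun s => a s t) (Ioo δ₁ δ₂))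
    (hat : ∀ s ∈ Ioo δ₁ δ₂, ContinuousOn (a s) S)
    (hker : ∀ s ∈ Ioo δ₁ δ₂, ∀ s' ∈ Ioo δ₁ δ₂, s ≠ s' → ∀ t ∈ S, ∀ t' ∈ S,
      ‖oscKernel (a s t - a s' t') (t - t') A B‖ ≤ c * (√|s - s'|)⁻¹) {h : ℝ → ℂ}
    (hk : MemLp (fun l => ((√√l : ℝ) : ℂ) * h l) 2 (volume.restrict (Ioc A B))) :
    AEMeasurable (fun s => ⨆ t ∈ S, ‖truncatedEvolution h A B (a s t) t‖ₑ)
      (volume.restrict (Ioo δ₁ δ₂)) ∧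
    ∫⁻ s in Ioo δ₁ δ₂, (⨆ t ∈ S, ‖truncatedEvolution h A B (a s t) t‖ₑ) ^ 2 ≤
      ENNReal.ofReal (c * (4 * √(δ₂ - δ₁))) *
        ∫⁻ l in Ioc A B, ‖((√√l : ℝ) : ℂ) * h l‖ₑ ^ 2 := by
  have hh := integrableOn_of_memLp_weight hA hk
  have hcont := continuous_truncatedEvolution hh
  have : Nonempty S := hS.to_subtype
  set d : ℕ → S := TopologicalSpace.denseSeq S with hd
  set a' : ℕ → ℝ → ℝ := fun n => (Ioo δ₁ δ₂).indicator fun s => a s (d n) with ha'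
  have ha'm : ∀ n, Measurable (a' n) := by
    intro n
    classical
    simp only [ha']
    rw [← piecewise_eq_indicator]
    exact (has (d n) (d n).2).measurable_piecewise continuousOn_const measurableSet_Ioo
  have ha'eq : ∀ n, ∀ s ∈ Ioo δ₁ δ₂, a' n s = a s (d n) := fun n s hs => indicator_of_mem hs _
  set G : ℕ → ℝ → ℝ≥0∞ := fun n s => ‖truncatedEvolution h A B (a' n s) (d n)‖ₑ with hG
  have hGm : ∀ n, Measurable (G n) := fun n =>
    (hcont.measurable.comp ((ha'm n).prodMk measurable_const)).enorm
  have hsup : ∀ s ∈ Ioo δ₁ δ₂, (⨆ t ∈ S, ‖truncatedEvolution h A B (a s t) t‖ₑ) = ⨆ n, G n s := by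
    intro s hs
    apply le_antisymm
    · refine iSup₂_le fun t ht => ?_
      have hc1 : Continuous fun t : S => ‖truncatedEvolution h A B (a s t) t‖ₑ :=
        (hcont.comp ((continuousOn_iff_continuous_domRestrict.1 (hat s hs)).prodMk
          continuous_subtype_val)).enorm
      refine DenseRange.induction_on (TopologicalSpace.denseRange_denseSeq S)
        (p := fun t : S => ‖truncatedEvolution h A B (a s t) t‖ₑ ≤ ⨆ n, G n s) ⟨t, ht⟩
        (isClosed_le hc1 continuous_const) fun n => ?_
      refine le_trans (le_of_eq ?_) (le_iSup (fun n => G n s) n)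
      simp only [hG, ha'eq n s hs, hd]
    · refine iSup_le fun n => ?_
      simp only [hG, ha'eq n s hs]
      exact le_iSup₂ (f := fun t (_ : t ∈ S) => ‖truncatedEvolution h A B (a s t) t‖ₑ)
        (d n : ℝ) (d n).2
  constructor
  · refine ⟨fun s => ⨆ n, G n s, Measurable.iSup hGm, ?_⟩
    filter_upwards [ae_restrict_mem measurableSet_Ioo] with s hs using hsup s hs
  rw [setLIntegral_congr_fun (g := fun s => (⨆ n, G n s) ^ 2) measurableSet_Ioo
    fun s hs => by simp only [hsup s hs]]
  refine lintegral_iSup_sq_le_of_selection hGm fun i hi => ?_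
  have m1 : Measurable fun s => a' (i s) s := measurable_eval_selection ha'm hi
  have m2 : Measurable fun s => (d (i s) : ℝ) :=
    (measurable_from_nat (f := fun n => (d n : ℝ))).comp hi
  refine lintegral_truncatedEvolution_sq_le hδ hA hAB hc m1 m2 (fun s hs s' hs' hne => ?_) hk
  rw [ha'eq _ s hs, ha'eq _ s' hs']
  exact hker s hs s' hs' hne _ (d _).2 _ (d _).2

/-! ### Poisson integrals and Bessel's equation -/

theorem intervalIntegrable_one_sub_sq_rpow {ν : ℝ} (hν : -1 < ν) :
    IntervalIntegrable (fun u : ℝ => (1 - u ^ 2) ^ ν) volume (-1) 1 := by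
  rw [intervalIntegrable_iff_integrableOn_Ioo_of_le (by norm_num)]
  have h1 : IntegrableOn (fun u : ℝ => (1 + u) ^ ν) (Ioo (-1) 1) := by
    have := (intervalIntegral.intervalIntegrable_rpow' (a := 0) (b := 2) hν).comp_add_left 1
    rw [← intervalIntegrable_iff_integrableOn_Ioo_of_le (by norm_num)]
    convert this using 1 <;> norm_num
  have h2 : IntegrableOn (fun u : ℝ => (1 - u) ^ ν) (Ioo (-1) 1) := by
    have := ((intervalIntegral.intervalIntegrable_rpow' (a := 0) (b := 2) hν).comp_sub_left 1).symm
    rw [← intervalIntegrable_iff_integrableOn_Ioo_of_le (by norm_num)]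
    convert this using 1 <;> norm_num
  have h3 : IntegrableOn (fun _ : ℝ => (1 : ℝ)) (Ioo (-1) 1) := by
    rw [integrableOn_const_iff]; simp
  refine ((h1.add h2).add h3).mono' (Measurable.aestronglyMeasurable (by fun_prop)) ?_
  filter_upwards [ae_restrict_mem measurableSet_Ioo] with u hu
  have e1 : 0 < 1 + u := by linarith [hu.1]
  have e2 : 0 < 1 - u := by linarith [hu.2]
  have e3 : 0 < 1 - u ^ 2 := by nlinarith
  rw [Real.norm_of_nonneg (by positivity)]
  change (1 - u ^ 2) ^ ν ≤ (1 + u) ^ ν + (1 - u) ^ ν + 1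
  have p1 : 0 ≤ (1 + u) ^ ν := by positivity
  have p2 : 0 ≤ (1 - u) ^ ν := by positivity
  rcases le_total 0 ν with h | h
  · have : (1 - u ^ 2) ^ ν ≤ 1 := Real.rpow_le_one e3.le (by nlinarith) h
    linarith
  · rcases le_total u 0 with hu0 | hu0
    · have := Real.rpow_le_rpow_of_nonpos e1 (show 1 + u ≤ 1 - u ^ 2 by nlinarith) h
      linarith
    · have := Real.rpow_le_rpow_of_nonpos e2 (show 1 - u ≤ 1 - u ^ 2 by nlinarith) h
      linarith

theorem intervalIntegrable_ofReal_one_sub_sq_rpow {ν : ℝ} (hν : -1 < ν) :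
    IntervalIntegrable (fun u : ℝ => (((1 - u ^ 2) ^ ν : ℝ) : ℂ)) volume (-1) 1 :=
  ⟨(intervalIntegrable_one_sub_sq_rpow hν).1.ofReal,
    (intervalIntegrable_one_sub_sq_rpow hν).2.ofReal⟩

theorem norm_exp_I_mul_mul (z u : ℝ) : ‖Complex.exp (Complex.I * z * u)‖ = 1 := by
  rw [mul_assoc, ← Complex.ofReal_mul, mul_comm, Complex.norm_exp_ofReal_mul_I]

/-- Differentiation of the Fourier integral of an integrable function on `[-1, 1]`. -/
theorem hasDerivAt_integral_exp_mul {φ : ℝ → ℂ} (hφ : IntervalIntegrable φ volume (-1) 1) (z : ℝ) :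
    HasDerivAt (fun z : ℝ => ∫ u in (-1 : ℝ)..1, Complex.exp (Complex.I * z * u) * φ u)
      (∫ u in (-1 : ℝ)..1, Complex.exp (Complex.I * z * u) * (Complex.I * u * φ u)) z := by
  rw [intervalIntegrable_iff] at hφ
  have hIoc : uIoc (-1 : ℝ) 1 = Ioc (-1) 1 := uIoc_of_le (by norm_num)
  have hm : AEStronglyMeasurable φ (volume.restrict (uIoc (-1 : ℝ) 1)) := hφ.aestronglyMeasurable
  refine (intervalIntegral.hasDerivAt_integral_of_dominated_loc_of_deriv_le (𝕜 := ℝ)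
    (bound := fun u => ‖φ u‖) (F' := fun z u => Complex.exp (Complex.I * z * u) *
      (Complex.I * u * φ u)) Filter.univ_mem (.of_forall fun w => ?_) ?_ ?_ ?_ ?_ ?_).2
  · exact (Continuous.aestronglyMeasurable (by fun_prop)).mul hm
  · rw [intervalIntegrable_iff]
    refine hφ.norm.mono' ((Continuous.aestronglyMeasurable (by fun_prop)).mul hm)
      (.of_forall fun u => ?_)
    rw [norm_mul, norm_exp_I_mul_mul, one_mul]
  · exact (Continuous.aestronglyMeasurable (by fun_prop)).mul
      ((Continuous.aestronglyMeasurable (by fun_prop)).mul hm)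
  · refine .of_forall fun u hu w _ => ?_
    rw [hIoc] at hu
    rw [norm_mul, norm_exp_I_mul_mul, one_mul, norm_mul, norm_mul, Complex.norm_I, one_mul,
      Complex.norm_real, Real.norm_eq_abs]
    have : |u| ≤ 1 := abs_le.2 ⟨hu.1.le, hu.2⟩
    exact mul_le_of_le_one_left (norm_nonneg _) this
  · rw [intervalIntegrable_iff]; exact hφ.norm
  · refine .of_forall fun u _ w _ => ?_
    have h1 : HasDerivAt (fun w : ℝ => Complex.I * (w : ℂ) * u) (Complex.I * 1 * u) w :=
      ((Complex.ofRealCLM.hasDerivAt (x := w)).const_mul Complex.I).mul_const (u : ℂ)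
    refine (h1.cexp.mul_const (φ u)).congr_deriv ?_
    ring

/-- The derivative of `modifiedBesselJ μ`, as a Poisson integral. -/
noncomputable def modifiedBesselJDeriv (μ z : ℝ) : ℂ :=
  ∫ u in (-1 : ℝ)..1, Complex.exp (Complex.I * z * u) *
    (Complex.I * u * (((1 - u ^ 2) ^ (μ - 1 / 2) : ℝ) : ℂ))

theorem hasDerivAt_modifiedBesselJ {μ : ℝ} (hμ : -1 / 2 < μ) (z : ℝ) :
    HasDerivAt (modifiedBesselJ μ) (modifiedBesselJDeriv μ z) z :=
  hasDerivAt_integral_exp_mul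
    (intervalIntegrable_ofReal_one_sub_sq_rpow (by linarith)) z

/-- Bessel's equation `𝒥'' + ((2μ + 1) / z) 𝒥' + 𝒥 = 0`. -/
theorem hasDerivAt_modifiedBesselJDeriv {μ : ℝ} (hμ : -1 / 2 < μ) {z : ℝ} (hz : z ≠ 0) :
    HasDerivAt (modifiedBesselJDeriv μ)
      (-modifiedBesselJ μ z - ((2 * μ + 1) / z : ℝ) * modifiedBesselJDeriv μ z) z := by
  set φ : ℝ → ℂ := fun u => (((1 - u ^ 2) ^ (μ - 1 / 2) : ℝ) : ℂ) with hφdef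
  have hφ : IntervalIntegrable φ volume (-1) 1 :=
    intervalIntegrable_ofReal_one_sub_sq_rpow (by linarith)
  have hcφ : ∀ p : ℝ → ℂ, Continuous p →
      IntervalIntegrable (fun u => p u * φ u) volume (-1) 1 := fun p hp =>
    hφ.continuousOn_mul hp.continuousOn
  have hφ' : IntervalIntegrable (fun u : ℝ => Complex.I * u * φ u) volume (-1) 1 :=
    hcφ _ (by fun_prop)
  refine (hasDerivAt_integral_exp_mul hφ' z).congr_deriv ?_
  -- integrate the derivative of `e^{izu} (1 - u²)^{μ + 1/2}`, which vanishes at `±1`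
  set ψ : ℝ → ℂ := fun u => Complex.exp (Complex.I * z * u) *
    (((1 - u ^ 2) ^ (μ + 1 / 2) : ℝ) : ℂ) with hψ
  set ψ' : ℝ → ℂ := fun u => Complex.exp (Complex.I * z * u) * ((Complex.I * z * (1 - u ^ 2)
    - (2 * μ + 1) * u) * φ u) with hψ'
  have hexp : Continuous fun u : ℝ => Complex.exp (Complex.I * z * u) := by fun_prop
  have hFTC : ∫ u in (-1 : ℝ)..1, ψ' u = ψ 1 - ψ (-1) := by
    refine intervalIntegral.integral_eq_sub_of_hasDeriv_right_of_le (by norm_num) ?_ ?_ ?_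
    · refine hexp.continuousOn.mul (Complex.continuous_ofReal.comp ?_).continuousOn
      exact Continuous.rpow_const (by fun_prop) fun _ => Or.inr (by linarith)
    · intro u hu
      have e3 : 0 < 1 - u ^ 2 := by nlinarith [hu.1, hu.2]
      have h1 : HasDerivAt (fun w : ℝ => Complex.I * z * (w : ℂ)) (Complex.I * z * 1) u :=
        (Complex.ofRealCLM.hasDerivAt (x := u)).const_mul (Complex.I * z)
      have h2 : HasDerivAt (fun u : ℝ => 1 - u ^ 2) (-(2 * u)) u := by
        simpa using ((hasDerivAt_id u).pow 2).const_sub 1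
      have h3 := (h2.rpow_const (p := μ + 1 / 2) (Or.inl e3.ne')).ofReal_comp
      refine ((h1.cexp.mul h3).congr_deriv ?_).hasDerivWithinAt
      have e4 : (1 - u ^ 2) ^ (μ + 1 / 2) = (1 - u ^ 2) ^ (μ - 1 / 2) * (1 - u ^ 2) := by
        rw [← Real.rpow_add_one e3.ne']; congr 1; ring
      simp only [hψ', hφdef]
      rw [e4, show μ + 1 / 2 - 1 = μ - 1 / 2 by ring]
      push_cast
      ring
    · simp only [hψ', ← mul_assoc]
      exact hcφ _ (by fun_prop)
  have hψ0 : ψ 1 - ψ (-1) = 0 := by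
    have : μ + 1 / 2 ≠ 0 := by linarith
    have e1 : (1 : ℝ) - 1 ^ 2 = 0 := by norm_num
    have e2 : (1 : ℝ) - (-1) ^ 2 = 0 := by norm_num
    simp only [hψ]
    rw [e1, e2, Real.zero_rpow this]
    simp
  rw [hψ0] at hFTC
  have i1 : IntervalIntegrable (fun u : ℝ => Complex.exp (Complex.I * z * u) *
      (Complex.I * u * (Complex.I * u * φ u))) volume (-1) 1 := by
    simp only [← mul_assoc]
    exact hcφ _ (by fun_prop)
  have i2 : IntervalIntegrable (fun u : ℝ => Complex.exp (Complex.I * z * u) * φ u)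
      volume (-1) 1 := hcφ _ hexp
  have i3 : IntervalIntegrable (fun u : ℝ => Complex.exp (Complex.I * z * u) *
      (Complex.I * u * φ u)) volume (-1) 1 := by
    simp only [← mul_assoc]
    exact hcφ _ (by fun_prop)
  have hz' : (z : ℂ) ≠ 0 := by exact_mod_cast hz
  have hsplit : ∫ u in (-1 : ℝ)..1, ψ' u =
      Complex.I * z * ((∫ u in (-1 : ℝ)..1, Complex.exp (Complex.I * z * u) *
        (Complex.I * u * (Complex.I * u * φ u))) + modifiedBesselJ μ z) +
      Complex.I * (2 * μ + 1) * modifiedBesselJDeriv μ z := by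
    rw [modifiedBesselJ, modifiedBesselJDeriv, ← intervalIntegral.integral_add i1 i2,
      ← intervalIntegral.integral_const_mul, ← intervalIntegral.integral_const_mul,
      ← intervalIntegral.integral_add ((i1.add i2).const_mul _) (i3.const_mul _)]
    congr 1; ext u
    simp only [hψ']
    linear_combination (-(Complex.exp (Complex.I * z * u) * φ u) * (Complex.I * z * u ^ 2 +
      (2 * μ + 1) * u)) * Complex.I_sq
  rw [hsplit] at hFTC
  generalize (∫ u in (-1 : ℝ)..1, Complex.exp (Complex.I * z * u) *
    (Complex.I * u * (Complex.I * u * φ u))) = J at hFTC ⊢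
  have hI : Complex.I ≠ 0 := Complex.I_ne_zero
  push_cast
  field_simp
  have := mul_left_cancel₀ hI (show Complex.I * (z * (J + modifiedBesselJ μ z) +
    (2 * μ + 1) * modifiedBesselJDeriv μ z) = Complex.I * 0 by linear_combination hFTC)
  linear_combination this

/-! ### Asymptotics of the Bessel function -/

/-- Energy bound for `W'' + W = (κ / z²) W`: the energy `E = |W|² + |W'|²` satisfies
`E' ≤ (|κ| / z²) E`, so that `E e^{|κ|/z}` decreases. -/
theorem exists_norm_le_of_perturbed_oscillator {W V : ℝ → ℂ} {κ z₀ : ℝ} (hz₀ : 0 < z₀)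
    (hW : ∀ z, 0 < z → HasDerivAt W (V z) z)
    (hV : ∀ z, 0 < z → HasDerivAt V (-W z + ((κ / z ^ 2 : ℝ) : ℂ) * W z) z) :
    ∃ C, 0 ≤ C ∧ ∀ z, z₀ ≤ z → ‖W z‖ ≤ C := by
  set L : ℝ → ℝ := fun z => (‖W z‖ ^ 2 + ‖V z‖ ^ 2) * Real.exp (|κ| * z⁻¹) with hL
  have hLd : ∀ z, 0 < z → HasDerivAt L
      ((2 * inner ℝ (W z) (V z) + 2 * inner ℝ (V z) (-W z + ((κ / z ^ 2 : ℝ) : ℂ) * W z)) *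
        Real.exp (|κ| * z⁻¹) + (‖W z‖ ^ 2 + ‖V z‖ ^ 2) *
          (Real.exp (|κ| * z⁻¹) * (|κ| * (-(z ^ 2)⁻¹)))) z := by
    intro z hz
    exact ((hW z hz).norm_sq.add (hV z hz).norm_sq).mul
      (((hasDerivAt_inv hz.ne').const_mul |κ|).exp)
  have hanti : AntitoneOn L (Ici z₀) := by
    refine antitoneOn_of_hasDerivWithinAt_nonpos (convex_Ici z₀)
      (fun z hz => (hLd z (hz₀.trans_le hz)).continuousAt.continuousWithinAt)
      (fun z hz => (hLd z (hz₀.trans_le (interior_subset hz))).hasDerivWithinAt) fun z hz => ?_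
    have hz0 : 0 < z := hz₀.trans_le (interior_subset hz)
    have e1 : inner ℝ (V z) (-W z + ((κ / z ^ 2 : ℝ) : ℂ) * W z) =
        -inner ℝ (W z) (V z) + κ / z ^ 2 * inner ℝ (W z) (V z) := by
      rw [inner_add_right, inner_neg_right, ← Complex.real_smul, inner_smul_right,
        real_inner_comm]
    have e2 : |inner ℝ (W z) (V z)| ≤ ‖W z‖ * ‖V z‖ := abs_real_inner_le_norm _ _
    have e3 : κ * inner ℝ (W z) (V z) ≤ |κ| * (‖W z‖ * ‖V z‖) :=
      (le_abs_self _).trans (by rw [abs_mul]; gcongr)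
    have e4 : 2 * (κ * inner ℝ (W z) (V z)) ≤ |κ| * (‖W z‖ ^ 2 + ‖V z‖ ^ 2) := by
      have := mul_nonneg (abs_nonneg κ) (sq_nonneg (‖W z‖ - ‖V z‖))
      linarith
    have e5 : (2 * inner ℝ (W z) (V z) + 2 * inner ℝ (V z) (-W z + ((κ / z ^ 2 : ℝ) : ℂ) * W z)) *
        Real.exp (|κ| * z⁻¹) + (‖W z‖ ^ 2 + ‖V z‖ ^ 2) *
          (Real.exp (|κ| * z⁻¹) * (|κ| * (-(z ^ 2)⁻¹))) =
        -(Real.exp (|κ| * z⁻¹) * (z ^ 2)⁻¹ * (|κ| * (‖W z‖ ^ 2 + ‖V z‖ ^ 2) -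
          2 * (κ * inner ℝ (W z) (V z)))) := by
      rw [e1]; ring
    rw [e5]
    exact neg_nonpos.2 (mul_nonneg (by positivity) (by linarith))
  refine ⟨√(L z₀), Real.sqrt_nonneg _, fun z hz => Real.le_sqrt_of_sq_le ?_⟩
  have h1 : L z ≤ L z₀ := hanti self_mem_Ici hz hz
  have h2 : 1 ≤ Real.exp (|κ| * z⁻¹) := Real.one_le_exp (by have := hz₀.trans_le hz; positivity)
  have h3 : ‖W z‖ ^ 2 + ‖V z‖ ^ 2 ≤ L z := le_mul_of_one_le_right (by positivity) h2
  nlinarith [sq_nonneg ‖V z‖]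

/-- Solutions of `W'' + W = (κ / z²) W` are asymptotic to free oscillations, with error `O(1/z)`:
the coefficients `e^{∓iz} (W' ± iW)` have derivative `O(1/z²)`. -/
theorem exists_asymptotics_of_perturbed_oscillator {W V : ℝ → ℂ} {κ z₀ : ℝ} (hz₀ : 0 < z₀)
    (hW : ∀ z, 0 < z → HasDerivAt W (V z) z)
    (hV : ∀ z, 0 < z → HasDerivAt V (-W z + ((κ / z ^ 2 : ℝ) : ℂ) * W z) z) :
    ∃ c₁ c₂ : ℂ, ∃ C : ℝ, 0 ≤ C ∧ ∀ z, z₀ ≤ z →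
      ‖W z - (c₁ * Complex.exp (Complex.I * z) + c₂ * Complex.exp (-(Complex.I * z)))‖ ≤ C / z := by
  obtain ⟨C₀, hC₀, hWb⟩ := exists_norm_le_of_perturbed_oscillator hz₀ hW hV
  have hlim : ∀ σ : ℝ, σ ^ 2 = 1 → ∃ c : ℂ, ∀ z, z₀ ≤ z →
      ‖Complex.exp (-(σ * Complex.I * z)) * (V z + σ * Complex.I * W z) - c‖ ≤ |κ| * C₀ / z := by
    intro σ hσ
    have hσ' : (σ : ℂ) ^ 2 = 1 := by exact_mod_cast hσ
    set D : ℝ → ℂ := fun z => Complex.exp (-(σ * Complex.I * z)) *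
      (V z + σ * Complex.I * W z) with hD
    set D' : ℝ → ℂ := fun z => Complex.exp (-(σ * Complex.I * z)) *
      (((κ / z ^ 2 : ℝ) : ℂ) * W z) with hD'
    have hDd : ∀ z, 0 < z → HasDerivAt D (D' z) z := by
      intro z hz
      have h1 : HasDerivAt (fun w : ℝ => -(σ * Complex.I * (w : ℂ))) (-(σ * Complex.I * 1)) z :=
        ((Complex.ofRealCLM.hasDerivAt (x := z)).const_mul (σ * Complex.I)).neg
      refine (h1.cexp.mul ((hV z hz).add ((hW z hz).const_mul (σ * Complex.I)))).congr_deriv ?_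
      simp only [hD', Pi.add_apply]
      linear_combination (-Complex.exp (-(σ * Complex.I * z)) * W z * Complex.I ^ 2) * hσ' -
        Complex.exp (-(σ * Complex.I * z)) * W z * Complex.I_sq
    have hD'b : ∀ z, z₀ ≤ z → ‖D' z‖ ≤ |κ| * C₀ * z ^ (-2 : ℝ) := by
      intro z hz
      have hz0 : 0 < z := hz₀.trans_le hz
      have e1 : ‖Complex.exp (-(σ * Complex.I * z))‖ = 1 := by
        rw [show -(σ * Complex.I * z) = ((-(σ * z) : ℝ) : ℂ) * Complex.I by push_cast; ring,
          Complex.norm_exp_ofReal_mul_I]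
      simp only [hD']
      rw [norm_mul, e1, one_mul, norm_mul, Complex.norm_real, Real.norm_eq_abs, abs_div,
        abs_of_nonneg (sq_nonneg z), Real.rpow_neg hz0.le, Real.rpow_two]
      have := hWb z hz
      calc |κ| / z ^ 2 * ‖W z‖ ≤ |κ| / z ^ 2 * C₀ := by gcongr
        _ = _ := by ring
    have hWc : ContinuousOn W (Ioi 0) := fun z hz => (hW z hz).continuousAt.continuousWithinAt
    have hD'c : ContinuousOn D' (Ioi 0) := by
      refine Continuous.continuousOn (by fun_prop) |>.mul
        ((Complex.continuous_ofReal.comp_continuousOn ?_).mul hWc)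
      exact continuousOn_const.div (by fun_prop) fun z hz => pow_ne_zero 2 (ne_of_gt hz)
    have hint : ∀ z, z₀ ≤ z → IntegrableOn (fun z : ℝ => |κ| * C₀ * z ^ (-2 : ℝ)) (Ioi z) :=
      fun z hz => (integrableOn_Ioi_rpow_of_lt (by norm_num) (hz₀.trans_le hz)).const_mul _
    have hD'i : ∀ z, z₀ ≤ z → IntegrableOn D' (Ioi z) := by
      intro z hz
      refine (hint z hz).mono' ((hD'c.mono fun y hy => (hz₀.trans_le hz).trans hy
        ).aestronglyMeasurable measurableSet_Ioi) ?_
      filter_upwards [ae_restrict_mem measurableSet_Ioi] with y hy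
      exact hD'b y (hz.trans (le_of_lt hy))
    have htend := tendsto_limUnder_of_hasDerivAt_of_integrableOn_Ioi
      (fun z hz => hDd z (hz₀.trans hz)) (hD'i z₀ le_rfl)
    refine ⟨Filter.atTop.limUnder D, fun z hz => ?_⟩
    have hz0 : 0 < z := hz₀.trans_le hz
    have heq := integral_Ioi_of_hasDerivAt_of_tendsto
      (hDd z hz0).continuousAt.continuousWithinAt
      (fun y hy => hDd y (hz0.trans hy)) (hD'i z hz) htend
    change ‖D z - _‖ ≤ _
    rw [← norm_neg, neg_sub, ← heq]
    calc ‖∫ y in Ioi z, D' y‖ ≤ ∫ y in Ioi z, |κ| * C₀ * y ^ (-2 : ℝ) := by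
          refine norm_integral_le_of_norm_le (hint z hz) ?_
          filter_upwards [ae_restrict_mem measurableSet_Ioi] with y hy
          exact hD'b y (hz.trans (le_of_lt hy))
      _ = |κ| * C₀ / z := by
          rw [integral_const_mul, integral_Ioi_rpow_of_lt (by norm_num) hz0]
          norm_num
          rw [Real.rpow_neg_one]
          ring
  obtain ⟨p, hp⟩ := hlim 1 (by norm_num)
  obtain ⟨q, hq⟩ := hlim (-1) (by norm_num)
  refine ⟨p / (2 * Complex.I), -q / (2 * Complex.I), |κ| * C₀, by positivity, fun z hz => ?_⟩
  have h1 := hp z hz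
  have h2 := hq z hz
  set A := Complex.exp (-(((1 : ℝ) : ℂ) * Complex.I * z)) * (V z + ((1 : ℝ) : ℂ) * Complex.I * W z)
    with hA
  set B := Complex.exp (-(((-1 : ℝ) : ℂ) * Complex.I * z)) *
    (V z + ((-1 : ℝ) : ℂ) * Complex.I * W z) with hB
  have e1 : Complex.exp (Complex.I * z) * A = V z + Complex.I * W z := by
    rw [hA, ← mul_assoc, ← Complex.exp_add]
    simp
  have e2 : Complex.exp (-(Complex.I * z)) * B = V z - Complex.I * W z := by
    rw [hB, ← mul_assoc, ← Complex.exp_add]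
    simp
    ring
  have hI : (2 * Complex.I) ≠ 0 := by simp
  have e3 : W z - (p / (2 * Complex.I) * Complex.exp (Complex.I * z) +
      -q / (2 * Complex.I) * Complex.exp (-(Complex.I * z))) =
      (Complex.exp (Complex.I * z) * (A - p) - Complex.exp (-(Complex.I * z)) * (B - q)) /
        (2 * Complex.I) := by
    rw [mul_sub, mul_sub, e1, e2]
    field_simp
    ring
  have n1 : ‖Complex.exp (Complex.I * z)‖ = 1 := norm_exp_I_mul_ofReal_eq_one z
  have n2 : ‖Complex.exp (-(Complex.I * z))‖ = 1 := by
    rw [Complex.exp_neg, norm_inv, n1, inv_one]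
  rw [e3, norm_div, norm_mul, Complex.norm_I, Complex.norm_ofNat, mul_one,
    div_le_iff₀ two_pos]
  refine (norm_sub_le _ _).trans ?_
  rw [norm_mul, norm_mul, n1, n2, one_mul, one_mul]
  linarith

/-- The two-term asymptotics of the Bessel function `𝒥_μ` at infinity. -/
theorem exists_modifiedBesselJ_asymptotics {μ : ℝ} (hμ : -1 / 2 < μ) {z₀ : ℝ} (hz₀ : 0 < z₀) :
    ∃ c₁ c₂ : ℂ, ∃ C : ℝ, 0 ≤ C ∧ ∀ z, z₀ ≤ z →
      ‖((z ^ (μ + 1 / 2) : ℝ) : ℂ) * modifiedBesselJ μ z -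
        (c₁ * Complex.exp (Complex.I * z) + c₂ * Complex.exp (-(Complex.I * z)))‖ ≤ C / z := by
  set m := μ + 1 / 2 with hm
  have hpow : ∀ z : ℝ, 0 < z → HasDerivAt (fun z : ℝ => ((z ^ m : ℝ) : ℂ))
      (((z ^ m : ℝ) : ℂ) * ((m / z : ℝ) : ℂ)) z := by
    intro z hz
    refine (Real.hasDerivAt_rpow_const (p := m) (Or.inl hz.ne')).ofReal_comp.congr_deriv ?_
    rw [Real.rpow_sub_one hz.ne']
    push_cast
    ring
  have hdiv : ∀ z : ℝ, 0 < z → HasDerivAt (fun z : ℝ => ((m / z : ℝ) : ℂ))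
      ((-(m / z ^ 2) : ℝ) : ℂ) z := by
    intro z hz
    refine HasDerivAt.ofReal_comp (((hasDerivAt_inv hz.ne').const_mul m).congr_deriv ?_)
    ring
  -- `z^m 𝒥(z)` solves `W'' + W = (m (m - 1) / z²) W`
  refine exists_asymptotics_of_perturbed_oscillator (κ := m * (m - 1)) hz₀
    (V := fun z => ((z ^ m : ℝ) : ℂ) * (modifiedBesselJDeriv μ z +
      ((m / z : ℝ) : ℂ) * modifiedBesselJ μ z)) (fun z hz => ?_) (fun z hz => ?_)
  · refine ((hpow z hz).mul (hasDerivAt_modifiedBesselJ hμ z)).congr_deriv ?_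
    ring
  · refine ((hpow z hz).mul ((hasDerivAt_modifiedBesselJDeriv hμ hz.ne').add
      ((hdiv z hz).mul (hasDerivAt_modifiedBesselJ hμ z)))).congr_deriv ?_
    have hz' : (z : ℂ) ≠ 0 := by exact_mod_cast hz.ne'
    rw [show 2 * μ + 1 = 2 * m by rw [hm]; ring]
    simp only [Pi.add_apply, Pi.mul_apply]
    push_cast
    field_simp
    ring

theorem norm_modifiedBesselJ_le {μ : ℝ} (z : ℝ) :
    ‖modifiedBesselJ μ z‖ ≤ ∫ u in (-1 : ℝ)..1, ‖(((1 - u ^ 2) ^ (μ - 1 / 2) : ℝ) : ℂ)‖ := by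
  refine (intervalIntegral.norm_integral_le_integral_norm (by norm_num)).trans (le_of_eq ?_)
  congr 1; ext u
  rw [norm_mul, norm_exp_I_mul_mul, one_mul]

theorem continuous_modifiedBesselJ {μ : ℝ} (hμ : -1 / 2 < μ) : Continuous (modifiedBesselJ μ) :=
  continuous_iff_continuousAt.2 fun z => (hasDerivAt_modifiedBesselJ hμ z).continuousAt

/-- The kernel `(lρ)^{μ + 1/2} 𝒥_μ(lρ)`, for `ρ` in a compact subset of `(0, ∞)`, differs from its
oscillating part at high frequencies by an error that is bounded and is `O(1/l)`. -/
theorem exists_besselKernel_decomposition {μ : ℝ} (hμ : -1 / 2 < μ) {ρ₁ ρ₂ : ℝ} (hρ₁ : 0 < ρ₁) :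
    ∃ c₁ c₂ : ℂ, ∃ C : ℝ, 0 ≤ C ∧ ∀ ρ ∈ Icc ρ₁ ρ₂,
      (∀ l ∈ Ioc (0 : ℝ) 1, ‖(((l * ρ) ^ (μ + 1 / 2) : ℝ) : ℂ) * modifiedBesselJ μ (l * ρ)‖ ≤ C) ∧
      ∀ l, 1 < l → ‖(((l * ρ) ^ (μ + 1 / 2) : ℝ) : ℂ) * modifiedBesselJ μ (l * ρ) -
        (c₁ * Complex.exp (Complex.I * ((l * ρ : ℝ) : ℂ)) +
          c₂ * Complex.exp (-(Complex.I * ((l * ρ : ℝ) : ℂ))))‖ ≤ C * l⁻¹ := by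
  obtain ⟨c₁, c₂, C, hC, h⟩ := exists_modifiedBesselJ_asymptotics hμ hρ₁
  set J₀ := ∫ u in (-1 : ℝ)..1, ‖(((1 - u ^ 2) ^ (μ - 1 / 2) : ℝ) : ℂ)‖
  have hJ₀ : 0 ≤ J₀ := (norm_nonneg _).trans (norm_modifiedBesselJ_le 0)
  refine ⟨c₁, c₂, |ρ₂| ^ (μ + 1 / 2) * J₀ + C / ρ₁, by positivity, fun ρ hρ => ⟨?_, ?_⟩⟩
  · intro l hl
    have hρ0 : 0 < ρ := hρ₁.trans_le hρ.1
    have hl0 := hl.1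
    rw [norm_mul, Complex.norm_real, Real.norm_of_nonneg (by positivity)]
    have h1 : (l * ρ) ^ (μ + 1 / 2) ≤ |ρ₂| ^ (μ + 1 / 2) := by
      refine Real.rpow_le_rpow (by positivity) ?_ (by linarith)
      exact (mul_le_of_le_one_left hρ0.le hl.2).trans (hρ.2.trans (le_abs_self _))
    have h2 := mul_le_mul h1 (norm_modifiedBesselJ_le (μ := μ) (l * ρ)) (norm_nonneg _)
      (by positivity)
    have h3 : 0 ≤ C / ρ₁ := by positivity
    linarith
  · intro l hl
    have hl0 : 0 < l := one_pos.trans hl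
    have hle : ρ₁ ≤ l * ρ := hρ.1.trans (le_mul_of_one_le_left (hρ₁.le.trans hρ.1) hl.le)
    refine (h _ hle).trans ?_
    have h1 : C / (l * ρ) ≤ C / ρ₁ * l⁻¹ := by
      rw [← div_eq_mul_inv, div_div, mul_comm ρ₁]
      gcongr
      exact hρ.1
    have h2 : 0 ≤ |ρ₂| ^ (μ + 1 / 2) * J₀ * l⁻¹ := by positivity
    rw [add_mul]
    linarith

/-! ### Reduction to dimension one -/

/-- Along curves that are Hölder of exponent `α ≥ 1/2` in time and bilipschitz in the parameter,
either the positions or the times of two space-time points are separated, on the parabolic scale,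
by the parameter distance; so the kernel is `O(|s - s'|^{-1/2})`. -/
theorem exists_norm_oscKernel_curve_le {C₄ C₅ δ₂ : ℝ} (hC₄ : 0 < C₄) (hC₅ : 0 < C₅)
    (hδ₂ : 0 < δ₂) : ∃ c, 0 < c ∧ ∀ α ∈ Icc (1 / 2 : ℝ) 1, ∀ (S : Set ℝ) (I : Set ℝ)
      (r : ℝ → ℝ → ℝ), I ⊆ Ico 0 δ₂ →
      (∀ s ∈ I, ∀ t ∈ S, ∀ t' ∈ S, |r s t - r s t'| ≤ C₄ * |t - t'| ^ α) →
      (∀ s ∈ I, ∀ s' ∈ I, ∀ t ∈ S, C₅ * |s - s'| ≤ |r s t - r s' t|) →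
      ∀ s ∈ I, ∀ s' ∈ I, s ≠ s' → ∀ t ∈ S, ∀ t' ∈ S, ∀ A B : ℝ, 0 < A → A ≤ B →
        ‖oscKernel (r s t - r s' t') (t - t') A B‖ ≤ c * (√|s - s'|)⁻¹ := by
  set e := min (C₅ / (2 * C₄)) (1 / δ₂) with he
  have he0 : 0 < e := lt_min (by positivity) (by positivity)
  refine ⟨34 * (√(C₅ / 2))⁻¹ + 13 * (√e)⁻¹, by positivity, ?_⟩
  intro α hα S I r hI hH hB s hs s' hs' hne t ht t' ht' A B hA hAB
  set d := |s - s'| with hd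
  have hd0 : 0 < d := abs_pos.2 (sub_ne_zero.2 hne)
  have hdδ : d ≤ δ₂ := by
    have h1 := hI hs
    have h2 := hI hs'
    exact abs_le.2 ⟨by linarith [h1.1, h2.2], by linarith [h1.2, h2.1]⟩
  rw [add_mul]
  rcases le_or_gt (C₄ * |t - t'| ^ α) (C₅ * d / 2) with hcase | hcase
  · -- the times are close: the positions are separated
    have h1 := hB s hs s' hs' t ht
    have h2 := hH s' hs' t ht t' ht'
    have h3 : C₅ / 2 * d ≤ |r s t - r s' t'| := by
      have h4 := abs_sub_abs_le_abs_sub (r s t - r s' t) (-(r s' t - r s' t'))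
      rw [abs_neg, sub_neg_eq_add, sub_add_sub_cancel] at h4
      linarith
    have h5 : 0 < C₅ / 2 * d := by positivity
    have h6 : r s t - r s' t' ≠ 0 := abs_pos.1 (h5.trans_le h3)
    have h7 : (√|r s t - r s' t'|)⁻¹ ≤ (√(C₅ / 2))⁻¹ * (√d)⁻¹ := by
      rw [← mul_inv, ← Real.sqrt_mul (by positivity)]
      exact inv_anti₀ (Real.sqrt_pos.2 h5) (Real.sqrt_le_sqrt h3)
    have h8 : 0 ≤ 13 * (√e)⁻¹ * (√d)⁻¹ := by positivity
    have h9 := norm_oscKernel_le_linear (b := t - t') hA hAB h6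
    linarith
  · -- the times are separated
    set b := |t - t'| with hb
    have hb0 : 0 ≤ b := abs_nonneg _
    have hα0 : 0 < α := by linarith [hα.1]
    have hq : C₅ / (2 * C₄) * d ≤ b ^ α := by
      rw [div_mul_eq_mul_div, div_le_iff₀ (by positivity)]
      linarith
    have hbpos : 0 < b := by
      rcases hb0.eq_or_lt with h | h
      · rw [← h, Real.zero_rpow hα0.ne', mul_zero] at hcase
        have : 0 < C₅ * d / 2 := by positivity
        linarith
      · exact h
    have hed : e * d ≤ √b := by
      rcases le_total b 1 with h1 | h1
      · calc e * d ≤ C₅ / (2 * C₄) * d := by gcongr; exact min_le_left _ _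
          _ ≤ b ^ α := hq
          _ ≤ b ^ (1 / 2 : ℝ) := Real.rpow_le_rpow_of_exponent_ge hbpos h1 hα.1
          _ = √b := (Real.sqrt_eq_rpow b).symm
      · calc e * d ≤ 1 / δ₂ * δ₂ := by gcongr; exact min_le_right _ _
          _ = 1 := by field_simp
          _ ≤ √b := Real.one_le_sqrt.2 h1
    have h5 : 0 < e * d := by positivity
    have h7 : (√√b)⁻¹ ≤ (√e)⁻¹ * (√d)⁻¹ := by
      rw [← mul_inv, ← Real.sqrt_mul he0.le]
      exact inv_anti₀ (Real.sqrt_pos.2 h5) (Real.sqrt_le_sqrt hed)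
    have h8 : 0 ≤ 34 * (√(C₅ / 2))⁻¹ * (√d)⁻¹ := by positivity
    have h9 := norm_oscKernel_le_quadratic (a := r s t - r s' t') hA hAB (abs_pos.1 hbpos)
    linarith

theorem continuousOn_of_abs_sub_le_rpow {f : ℝ → ℝ} {S : Set ℝ} {C α : ℝ} (hα : 0 < α)
    (h : ∀ t ∈ S, ∀ t' ∈ S, |f t - f t'| ≤ C * |t - t'| ^ α) : ContinuousOn f S := by
  intro t ht
  rw [ContinuousWithinAt, tendsto_iff_dist_tendsto_zero]
  have h1 : Filter.Tendsto (fun x => C * |x - t| ^ α) (nhdsWithin t S) (nhds 0) := by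
    have : Continuous fun x => C * |x - t| ^ α :=
      continuous_const.mul (Continuous.rpow_const (by fun_prop) fun _ => Or.inr hα.le)
    have h2 := this.tendsto t
    rw [sub_self, abs_zero, Real.zero_rpow hα.ne', mul_zero] at h2
    exact h2.mono_left nhdsWithin_le_nhds
  refine squeeze_zero' (.of_forall fun _ => dist_nonneg) ?_ h1
  filter_upwards [self_mem_nhdsWithin] with x hx
  exact h x hx t ht

/-- The weight `min(1, 1/l)` carried by the error term of the Bessel kernel. -/
noncomputable def errorWeight (l : ℝ) : ℝ := if l ≤ 1 then 1 else l⁻¹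

theorem measurable_errorWeight : Measurable errorWeight :=
  Measurable.ite measurableSet_Iic measurable_const measurable_inv

theorem errorWeight_pos {l : ℝ} (hl : 0 < l) : 0 < errorWeight l := by
  unfold errorWeight
  split_ifs <;> positivity

theorem lintegral_errorWeight_sq_lt_top :
    ∫⁻ l in Ioi (0 : ℝ), ENNReal.ofReal (errorWeight l * (√√l)⁻¹) ^ 2 < ∞ := by
  have hsq : ∀ l : ℝ, 0 < l → (√√l)⁻¹ ^ 2 = l ^ (-(1 / 2) : ℝ) := fun l hl => by
    rw [inv_pow, Real.sq_sqrt (Real.sqrt_nonneg _), Real.sqrt_eq_rpow, Real.rpow_neg hl.le]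
  have h1 : IntegrableOn (fun l => (errorWeight l * (√√l)⁻¹) ^ 2) (Ioc 0 1) := by
    have := (intervalIntegral.intervalIntegrable_rpow' (a := 0) (b := 1) (r := -(1 / 2))
      (by norm_num)).1
    refine IntegrableOn.congr_fun this (fun l hl => ?_) measurableSet_Ioc
    rw [mul_pow, hsq l hl.1, errorWeight, if_pos hl.2, one_pow, one_mul]
  have h2 : IntegrableOn (fun l => (errorWeight l * (√√l)⁻¹) ^ 2) (Ioi 1) := by
    have := integrableOn_Ioi_rpow_of_lt (a := -(5 / 2)) (by norm_num) (one_pos (α := ℝ))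
    refine IntegrableOn.congr_fun this (fun l hl => ?_) measurableSet_Ioi
    have hl0 : 0 < l := one_pos.trans hl
    rw [mul_pow, hsq l hl0, errorWeight, if_neg (not_le.2 hl), inv_pow, ← Real.rpow_natCast,
      ← Real.rpow_neg hl0.le, ← Real.rpow_add hl0]
    norm_num
  have h3 := (h1.union h2).lintegral_lt_top
  rw [Ioc_union_Ioi_eq_Ioi zero_le_one] at h3
  refine lt_of_eq_of_lt ?_ h3
  refine setLIntegral_congr_fun measurableSet_Ioi fun l hl => ?_
  rw [ENNReal.ofReal_pow]
  have := errorWeight_pos hl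
  positivity

/-- The Cauchy–Schwarz inequality for the error term. -/
theorem exists_lintegral_errorWeight_mul_le : ∃ Q : ℝ, 0 ≤ Q ∧ ∀ h : ℝ → ℂ,
    AEStronglyMeasurable h (volume.restrict (Ioi 0)) →
    ∫⁻ l in Ioi (0 : ℝ), ENNReal.ofReal (errorWeight l) * ‖h l‖ₑ ≤ ENNReal.ofReal Q *
      (∫⁻ l in Ioi (0 : ℝ), ‖((√√l : ℝ) : ℂ) * h l‖ₑ ^ 2) ^ (1 / 2 : ℝ) := by
  set q := (∫⁻ l in Ioi (0 : ℝ), ENNReal.ofReal (errorWeight l * (√√l)⁻¹) ^ 2) ^ (1 / 2 : ℝ) with hq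
  have hqtop : q ≠ ∞ := ENNReal.rpow_ne_top_of_nonneg (by norm_num)
    lintegral_errorWeight_sq_lt_top.ne
  refine ⟨q.toReal, ENNReal.toReal_nonneg, fun h hh => ?_⟩
  rw [ENNReal.ofReal_toReal hqtop]
  have hm1 : AEMeasurable (fun l : ℝ => ENNReal.ofReal (errorWeight l * (√√l)⁻¹))
      (volume.restrict (Ioi 0)) := by
    have := measurable_errorWeight
    exact Measurable.aemeasurable (by fun_prop)
  have hm2 : AEMeasurable (fun l : ℝ => ‖((√√l : ℝ) : ℂ) * h l‖ₑ) (volume.restrict (Ioi 0)) :=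
    (AEStronglyMeasurable.mul (Continuous.aestronglyMeasurable (by fun_prop)) hh).enorm
  have := ENNReal.lintegral_mul_le_Lp_mul_Lq (volume.restrict (Ioi 0))
    Real.HolderConjugate.two_two hm1 hm2
  simp only [ENNReal.rpow_two] at this
  refine le_trans (le_of_eq ?_) this
  refine setLIntegral_congr_fun measurableSet_Ioi fun l hl => ?_
  have hl0 : 0 < √√l := Real.sqrt_pos.2 (Real.sqrt_pos.2 hl)
  simp only [Pi.mul_apply]
  rw [enorm_mul, ← mul_assoc, ← ofReal_norm ((√√l : ℝ) : ℂ), Complex.norm_real,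
    Real.norm_of_nonneg hl0.le,
    ← ENNReal.ofReal_mul (by have := errorWeight_pos hl; positivity), mul_assoc,
    inv_mul_cancel₀ hl0.ne', mul_one]

theorem integrableOn_Ioc_zero_of_lintegral_errorWeight {h : ℝ → ℂ}
    (hh : AEStronglyMeasurable h (volume.restrict (Ioi 0)))
    (hfin : ∫⁻ l in Ioi (0 : ℝ), ENNReal.ofReal (errorWeight l) * ‖h l‖ₑ < ∞) {R : ℝ}
    (hR : 1 ≤ R) : IntegrableOn h (Ioc 0 R) := by
  refine ⟨hh.mono_measure (Measure.restrict_mono Ioc_subset_Ioi_self le_rfl), ?_⟩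
  have hR0 : 0 < R := one_pos.trans_le hR
  have hle : ∫⁻ l in Ioc (0 : ℝ) R, ‖h l‖ₑ ≤
      ENNReal.ofReal R * ∫⁻ l in Ioi (0 : ℝ), ENNReal.ofReal (errorWeight l) * ‖h l‖ₑ := by
    rw [← lintegral_const_mul' _ _ ENNReal.ofReal_ne_top]
    calc _ ≤ ∫⁻ l in Ioc (0 : ℝ) R,
          ENNReal.ofReal R * (ENNReal.ofReal (errorWeight l) * ‖h l‖ₑ) := by
          refine setLIntegral_mono_ae' measurableSet_Ioc (.of_forall fun l hl => ?_)
          rw [← mul_assoc, ← ENNReal.ofReal_mul hR0.le]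
          refine le_mul_of_one_le_left (zero_le) ?_
          rw [ENNReal.one_le_ofReal, errorWeight]
          split_ifs
          · linarith
          · rw [← div_eq_mul_inv, one_le_div hl.1]
            exact hl.2
      _ ≤ _ := lintegral_mono_set Ioc_subset_Ioi_self
  exact hle.trans_lt (ENNReal.mul_lt_top ENNReal.ofReal_lt_top hfin)

/-- Pointwise reduction to dimension one: up to an error controlled by the weighted norm, the
Hankel-type integral is a combination of two one-dimensional evolutions. -/
theorem norm_integral_besselKernel_le {μ : ℝ} (hμ : -1 / 2 < μ) {C : ℝ} {c₁ c₂ : ℂ}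
    (hC : 0 ≤ C) {ρ : ℝ}
    (hlow : ∀ l ∈ Ioc (0 : ℝ) 1,
      ‖(((l * ρ) ^ (μ + 1 / 2) : ℝ) : ℂ) * modifiedBesselJ μ (l * ρ)‖ ≤ C)
    (hhigh : ∀ l, 1 < l → ‖(((l * ρ) ^ (μ + 1 / 2) : ℝ) : ℂ) * modifiedBesselJ μ (l * ρ) -
        (c₁ * Complex.exp (Complex.I * ((l * ρ : ℝ) : ℂ)) +
          c₂ * Complex.exp (-(Complex.I * ((l * ρ : ℝ) : ℂ))))‖ ≤ C * l⁻¹)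
    {h : ℝ → ℂ} {R : ℝ} (hR : 1 ≤ R) (hh : IntegrableOn h (Ioc 0 R)) (t : ℝ) :
    ‖∫ l in Ioc 0 R, (((l * ρ) ^ (μ + 1 / 2) : ℝ) : ℂ) * modifiedBesselJ μ (l * ρ) *
        Complex.exp (Complex.I * ((t * l ^ 2 : ℝ) : ℂ)) * h l‖ₑ ≤
      2 * (ENNReal.ofReal C * ∫⁻ l in Ioi (0 : ℝ), ENNReal.ofReal (errorWeight l) * ‖h l‖ₑ) +
        (‖c₁‖ₑ * ‖truncatedEvolution h 1 R ρ t‖ₑ +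
          ‖c₂‖ₑ * ‖truncatedEvolution h 1 R (-ρ) t‖ₑ) := by
  set w : ℝ → ℂ := fun l => (((l * ρ) ^ (μ + 1 / 2) : ℝ) : ℂ) * modifiedBesselJ μ (l * ρ) with hw
  set e : ℝ → ℂ := fun l => Complex.exp (Complex.I * ((t * l ^ 2 : ℝ) : ℂ)) with he
  set p : ℝ → ℂ := fun l => c₁ * Complex.exp (Complex.I * ((l * ρ : ℝ) : ℂ)) +
    c₂ * Complex.exp (-(Complex.I * ((l * ρ : ℝ) : ℂ))) with hp
  have hen : ∀ l, ‖e l‖ = 1 := fun l => norm_exp_I_mul_ofReal_eq_one _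
  have hwc : Continuous w := (Complex.continuous_ofReal.comp (Continuous.rpow_const (by fun_prop)
    fun _ => Or.inr (by linarith))).mul ((continuous_modifiedBesselJ hμ).comp (by fun_prop))
  have hec : Continuous e := by fun_prop
  have hpc : Continuous p := by fun_prop
  have hh1 : IntegrableOn h (Ioc 0 1) := hh.mono_set (Ioc_subset_Ioc_right hR)
  have hh2 : IntegrableOn h (Ioc 1 R) := hh.mono_set (Ioc_subset_Ioc_left zero_le_one)
  have hpn : ∀ l, ‖p l‖ ≤ ‖c₁‖ + ‖c₂‖ := by
    intro l
    refine (norm_add_le _ _).trans ?_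
    rw [norm_mul, norm_mul, Complex.exp_neg, norm_inv, norm_exp_I_mul_ofReal_eq_one]
    simp
  have i1 : IntegrableOn (fun l => w l * e l * h l) (Ioc 0 1) := by
    refine Integrable.bdd_mul (c := C) hh1 (hwc.mul hec).aestronglyMeasurable ?_
    filter_upwards [ae_restrict_mem measurableSet_Ioc] with l hl
    rw [norm_mul, hen, mul_one]
    exact hlow l hl
  have i2 : IntegrableOn (fun l => (w l - p l) * e l * h l) (Ioc 1 R) := by
    refine Integrable.bdd_mul (c := C) hh2 ((hwc.sub hpc).mul hec).aestronglyMeasurable ?_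
    filter_upwards [ae_restrict_mem measurableSet_Ioc] with l hl
    rw [norm_mul, hen, mul_one]
    exact (hhigh l hl.1).trans (mul_le_of_le_one_right hC (inv_le_one_of_one_le₀ hl.1.le))
  have i3 : IntegrableOn (fun l => p l * e l * h l) (Ioc 1 R) := by
    refine Integrable.bdd_mul (c := ‖c₁‖ + ‖c₂‖) hh2 (hpc.mul hec).aestronglyMeasurable
      (.of_forall fun l => ?_)
    rw [norm_mul, hen, mul_one]
    exact hpn l
  have i4 : IntegrableOn (fun l => w l * e l * h l) (Ioc 1 R) := by
    refine (i2.add i3).congr (.of_forall fun l => ?_)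
    simp only [Pi.add_apply]
    ring
  have iev : ∀ a : ℝ, IntegrableOn (fun l =>
      Complex.exp (Complex.I * ((a * l + t * l ^ 2 : ℝ) : ℂ)) * h l) (Ioc 1 R) := fun a =>
    Integrable.bdd_mul (c := 1) hh2 (Continuous.aestronglyMeasurable (by fun_prop))
      (.of_forall fun l => (norm_exp_I_mul_ofReal_eq_one _).le)
  have hmain : ∫ l in Ioc 1 R, p l * e l * h l =
      c₁ * truncatedEvolution h 1 R ρ t + c₂ * truncatedEvolution h 1 R (-ρ) t := by
    rw [truncatedEvolution, truncatedEvolution, ← integral_const_mul, ← integral_const_mul,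
      ← integral_add ((iev ρ).const_mul c₁) ((iev (-ρ)).const_mul c₂)]
    congr 1; ext l
    have e1 : Complex.exp (Complex.I * ((ρ * l + t * l ^ 2 : ℝ) : ℂ)) =
        Complex.exp (Complex.I * ((l * ρ : ℝ) : ℂ)) * e l := by
      rw [he, ← Complex.exp_add]; congr 1; push_cast; ring
    have e2 : Complex.exp (Complex.I * ((-ρ * l + t * l ^ 2 : ℝ) : ℂ)) =
        Complex.exp (-(Complex.I * ((l * ρ : ℝ) : ℂ))) * e l := by
      rw [he, ← Complex.exp_add]; congr 1; push_cast; ring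
    rw [e1, e2, hp]
    ring
  have hsplit : ∫ l in Ioc 0 R, w l * e l * h l = (∫ l in Ioc 0 1, w l * e l * h l) +
      ((∫ l in Ioc 1 R, (w l - p l) * e l * h l) + ∫ l in Ioc 1 R, p l * e l * h l) := by
    rw [← Ioc_union_Ioc_eq_Ioc zero_le_one hR, setIntegral_union (Ioc_disjoint_Ioc_of_le le_rfl)
      measurableSet_Ioc i1 i4, ← integral_add i2 i3]
    congr 2; ext l; ring
  have hb : ∀ (T : Set ℝ) (f : ℝ → ℂ), MeasurableSet T → T ⊆ Ioi 0 →
      (∀ l ∈ T, ‖f l‖ ≤ C * errorWeight l) → ‖∫ l in T, f l * e l * h l‖ₑ ≤ ENNReal.ofReal C *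
        ∫⁻ l in Ioi (0 : ℝ), ENNReal.ofReal (errorWeight l) * ‖h l‖ₑ := by
    intro T f hT hT0 hf
    refine (enorm_integral_le_lintegral_enorm _).trans ?_
    rw [← lintegral_const_mul' _ _ ENNReal.ofReal_ne_top]
    refine le_trans ?_ (lintegral_mono_set hT0)
    refine setLIntegral_mono_ae' hT (.of_forall fun l hl => ?_)
    rw [← mul_assoc, ← ENNReal.ofReal_mul hC, enorm_mul]
    gcongr
    rw [← ofReal_norm, norm_mul, hen, mul_one]
    exact ENNReal.ofReal_le_ofReal (hf l hl)
  have b1 := hb (Ioc 0 1) w measurableSet_Ioc Ioc_subset_Ioi_self fun l hl => by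
    rw [errorWeight, if_pos hl.2, mul_one]
    exact hlow l hl
  have b2 := hb (Ioc 1 R) (fun l => w l - p l) measurableSet_Ioc
    (fun l hl => one_pos.trans hl.1) fun l hl => by
      rw [errorWeight, if_neg (not_le.2 hl.1)]
      exact hhigh l hl.1
  rw [hsplit, hmain, two_mul, add_assoc]
  refine (enorm_add_le _ _).trans (add_le_add b1 ((enorm_add_le _ _).trans (add_le_add b2 ?_)))
  refine (enorm_add_le _ _).trans (le_of_eq ?_)
  rw [enorm_mul, enorm_mul]

/-! ### The maximal estimate for radial data -/

/-- The radial evolution at time `t` and radius `ρ`, multiplied by `ρ^{μ + 1/2}` and restricted to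
the frequencies in `D`; here `h` is the spherical Fourier transform times `l^{μ + 1/2}`. -/
noncomputable def besselEvolution (μ : ℝ) (h : ℝ → ℂ) (D : Set ℝ) (t ρ : ℝ) : ℂ :=
  ∫ l in D, (((l * ρ) ^ (μ + 1 / 2) : ℝ) : ℂ) * modifiedBesselJ μ (l * ρ) *
    Complex.exp (Complex.I * ((t * l ^ 2 : ℝ) : ℂ)) * h l

/-- A bound for the truncated integrals passes to the integral over `(0, ∞)`, whether or not the
integrand is integrable there: the Bochner integral of a nonintegrable function is `0`. -/
theorem enorm_setIntegral_Ioi_sq_le_liminf {Φ : ℝ → ℂ} {B : ℕ → ℝ≥0∞}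
    (hB : ∀ N : ℕ, ‖∫ l in Ioc (0 : ℝ) (N + 1), Φ l‖ₑ ^ 2 ≤ B N) :
    ‖∫ l in Ioi (0 : ℝ), Φ l‖ₑ ^ 2 ≤ Filter.liminf B Filter.atTop := by
  by_cases hΦ : IntegrableOn Φ (Ioi 0)
  · have hU : ⋃ N : ℕ, Ioc (0 : ℝ) (N + 1) = Ioi 0 := by
      ext x
      simp only [mem_iUnion, mem_Ioc, mem_Ioi]
      refine ⟨fun ⟨_, h, _⟩ => h, fun h => ?_⟩
      obtain ⟨N, hN⟩ := exists_nat_ge x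
      exact ⟨N, h, by linarith⟩
    have hmono : Monotone fun N : ℕ => Ioc (0 : ℝ) (N + 1) := fun N N' hN =>
      Ioc_subset_Ioc_right (by gcongr)
    have htend := tendsto_setIntegral_of_monotone (f := Φ) (μ := volume)
      (fun N : ℕ => measurableSet_Ioc) hmono (by rwa [hU])
    rw [hU] at htend
    have h2 := ((ENNReal.continuous_pow 2).comp continuous_enorm).continuousAt.tendsto.comp htend
    have h3 := h2.liminf_eq
    simp only [Function.comp_def] at h3
    rw [← h3]
    exact Filter.liminf_le_liminf (.of_forall hB)
  · rw [integral_undef hΦ]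
    simp

theorem add_add_sq_le_nine_mul (a b c : ℝ≥0∞) :
    (a + b + c) ^ 2 ≤ 9 * (a ^ 2 + b ^ 2 + c ^ 2) := by
  have key : ∀ x : ℝ≥0∞, a ≤ x → b ≤ x → c ≤ x → (a + b + c) ^ 2 ≤ 9 * x ^ 2 := by
    intro x ha hb hc
    calc (a + b + c) ^ 2 ≤ (x + x + x) ^ 2 := by gcongr
      _ = 9 * x ^ 2 := by ring
  rcases le_total a b with h1 | h1 <;> rcases le_total b c with h2 | h2 <;>
    rcases le_total a c with h3 | h3
  · exact (key c h3 h2 le_rfl).trans (by gcongr; exact le_add_self)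
  · exact (key c (h1.trans h2) h2 le_rfl).trans (by gcongr; exact le_add_self)
  · exact (key b h1 le_rfl h2).trans (by gcongr; exact le_add_self.trans le_self_add)
  · exact (key b h1 le_rfl h2).trans (by gcongr; exact le_add_self.trans le_self_add)
  · exact (key c h3 h2 le_rfl).trans (by gcongr; exact le_add_self)
  · exact (key a le_rfl h1 h3).trans (by gcongr; exact le_self_add.trans le_self_add)
  · exact (key a le_rfl h1 (h2.trans h1)).trans (by gcongr; exact le_self_add.trans le_self_add)
  · exact (key a le_rfl h1 h3).trans (by gcongr; exact le_self_add.trans le_self_add)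

/-- The maximal estimate for the radial evolution, from the bound for the one-dimensional kernels
along `r` and `-r`. The frequency truncation is removed by Fatou's lemma. -/
theorem lintegral_iSup_besselEvolution_sq_le {μ : ℝ} (hμ : -1 / 2 < μ) {C Q c : ℝ} {c₁ c₂ : ℂ}
    (hC : 0 ≤ C) (hQ0 : 0 ≤ Q) (hc : 0 < c) {ρ₁ ρ₂ δ₁ δ₂ : ℝ} (hδ : δ₁ < δ₂)
    (hdec : ∀ ρ ∈ Icc ρ₁ ρ₂,
      (∀ l ∈ Ioc (0 : ℝ) 1, ‖(((l * ρ) ^ (μ + 1 / 2) : ℝ) : ℂ) * modifiedBesselJ μ (l * ρ)‖ ≤ C) ∧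
      ∀ l, 1 < l → ‖(((l * ρ) ^ (μ + 1 / 2) : ℝ) : ℂ) * modifiedBesselJ μ (l * ρ) -
        (c₁ * Complex.exp (Complex.I * ((l * ρ : ℝ) : ℂ)) +
          c₂ * Complex.exp (-(Complex.I * ((l * ρ : ℝ) : ℂ))))‖ ≤ C * l⁻¹)
    (hQ : ∀ h : ℝ → ℂ, AEStronglyMeasurable h (volume.restrict (Ioi 0)) →
      ∫⁻ l in Ioi (0 : ℝ), ENNReal.ofReal (errorWeight l) * ‖h l‖ₑ ≤ ENNReal.ofReal Q *
        (∫⁻ l in Ioi (0 : ℝ), ‖((√√l : ℝ) : ℂ) * h l‖ₑ ^ 2) ^ (1 / 2 : ℝ))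
    {S : Set ℝ} (hS : S.Nonempty) {r : ℝ → ℝ → ℝ}
    (hr : ∀ s ∈ Ioo δ₁ δ₂, ∀ t ∈ S, r s t ∈ Icc ρ₁ ρ₂)
    (hrs : ∀ t ∈ S, ContinuousOn (fun s => r s t) (Ioo δ₁ δ₂))
    (hrt : ∀ s ∈ Ioo δ₁ δ₂, ContinuousOn (r s) S)
    (hker₁ : ∀ s ∈ Ioo δ₁ δ₂, ∀ s' ∈ Ioo δ₁ δ₂, s ≠ s' → ∀ t ∈ S, ∀ t' ∈ S, ∀ A B : ℝ, 0 < A →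
      A ≤ B → ‖oscKernel (r s t - r s' t') (t - t') A B‖ ≤ c * (√|s - s'|)⁻¹)
    (hker₂ : ∀ s ∈ Ioo δ₁ δ₂, ∀ s' ∈ Ioo δ₁ δ₂, s ≠ s' → ∀ t ∈ S, ∀ t' ∈ S, ∀ A B : ℝ, 0 < A →
      A ≤ B → ‖oscKernel (-r s t - -r s' t') (t - t') A B‖ ≤ c * (√|s - s'|)⁻¹)
    {h : ℝ → ℂ} (hh : AEStronglyMeasurable h (volume.restrict (Ioi 0)))
    (hfin : ∫⁻ l in Ioi (0 : ℝ), ‖((√√l : ℝ) : ℂ) * h l‖ₑ ^ 2 < ∞) :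
    ∫⁻ s in Ioo δ₁ δ₂, (⨆ t ∈ S, ‖besselEvolution μ h (Ioi 0) t (r s t)‖ₑ) ^ 2 ≤
      ENNReal.ofReal ((2 * C * Q + ‖c₁‖ + ‖c₂‖) ^ 2 * 9 *
        ((δ₂ - δ₁) + 2 * (c * (4 * √(δ₂ - δ₁))))) *
          ∫⁻ l in Ioi (0 : ℝ), ‖((√√l : ℝ) : ℂ) * h l‖ₑ ^ 2 := by
  set X := ∫⁻ l in Ioi (0 : ℝ), ‖((√√l : ℝ) : ℂ) * h l‖ₑ ^ 2 with hX
  set M := c * (4 * √(δ₂ - δ₁)) with hM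
  have hM0 : 0 ≤ M := by positivity
  set P := 2 * C * Q + ‖c₁‖ + ‖c₂‖ with hP
  have hP0 : 0 ≤ P := by positivity
  have hkm : AEStronglyMeasurable (fun l => ((√√l : ℝ) : ℂ) * h l) (volume.restrict (Ioi 0)) :=
    (Continuous.aestronglyMeasurable (by fun_prop)).mul hh
  have hsub : ∀ N : ℕ, Ioc (1 : ℝ) (N + 1) ⊆ Ioi 0 := fun N l hl => one_pos.trans hl.1
  have hXN : ∀ N : ℕ, ∫⁻ l in Ioc (1 : ℝ) (N + 1), ‖((√√l : ℝ) : ℂ) * h l‖ₑ ^ 2 ≤ X := fun N =>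
    lintegral_mono_set (hsub N)
  have hmem : ∀ N : ℕ, MemLp (fun l => ((√√l : ℝ) : ℂ) * h l) 2
      (volume.restrict (Ioc 1 ((N : ℝ) + 1))) := fun N =>
    memLp_two_of_lintegral_lt_top (hkm.mono_measure (Measure.restrict_mono (hsub N) le_rfl))
      ((hXN N).trans_lt hfin)
  have hR : ∀ N : ℕ, (1 : ℝ) ≤ N + 1 := fun N => by have := N.cast_nonneg (α := ℝ); linarith
  set V₁ : ℕ → ℝ → ℝ≥0∞ := fun N s => ⨆ t ∈ S, ‖truncatedEvolution h 1 (N + 1) (r s t) t‖ₑ with hV₁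
  set V₂ : ℕ → ℝ → ℝ≥0∞ := fun N s => ⨆ t ∈ S, ‖truncatedEvolution h 1 (N + 1) (-r s t) t‖ₑ
    with hV₂
  have hmax₁ := fun N : ℕ => lintegral_iSup_truncatedEvolution_sq_le hδ one_pos (hR N) hc hS hrs hrt
    (fun s hs s' hs' hne t ht t' ht' => hker₁ s hs s' hs' hne t ht t' ht' 1 (N + 1) one_pos (hR N))
    (hmem N)
  have hmax₂ := fun N : ℕ => lintegral_iSup_truncatedEvolution_sq_le (a := fun s t => -r s t)
    hδ one_pos (hR N) hc hS (fun t ht => (hrs t ht).neg) (fun s hs => (hrt s hs).neg)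
    (fun s hs s' hs' hne t ht t' ht' => hker₂ s hs s' hs' hne t ht t' ht' 1 (N + 1) one_pos (hR N))
    (hmem N)
  have herr := hQ h hh
  have herrfin : ∫⁻ l in Ioi (0 : ℝ), ENNReal.ofReal (errorWeight l) * ‖h l‖ₑ < ∞ :=
    herr.trans_lt (ENNReal.mul_lt_top ENNReal.ofReal_lt_top
      (ENNReal.rpow_lt_top_of_nonneg (by norm_num) hfin.ne))
  set B : ℕ → ℝ → ℝ≥0∞ := fun N s =>
    ENNReal.ofReal P ^ 2 * (9 * (X + V₁ N s ^ 2 + V₂ N s ^ 2)) with hBdef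
  have hXsq : (X ^ (1 / 2 : ℝ)) ^ 2 = X := by
    rw [← ENNReal.rpow_two, ← ENNReal.rpow_mul]; norm_num
  have hpt : ∀ N : ℕ, ∀ s ∈ Ioo δ₁ δ₂, ∀ t ∈ S,
      ‖besselEvolution μ h (Ioc 0 (N + 1)) t (r s t)‖ₑ ^ 2 ≤ B N s := by
    intro N s hs t ht
    obtain ⟨hlow, hhigh⟩ := hdec (r s t) (hr s hs t ht)
    have h1 := norm_integral_besselKernel_le hμ hC hlow hhigh (hR N)
      (integrableOn_Ioc_zero_of_lintegral_errorWeight hh herrfin (hR N)) t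
    have hle₁ : ‖truncatedEvolution h 1 (N + 1) (r s t) t‖ₑ ≤ V₁ N s :=
      le_iSup₂ (f := fun t (_ : t ∈ S) => ‖truncatedEvolution h 1 (N + 1) (r s t) t‖ₑ) t ht
    have hle₂ : ‖truncatedEvolution h 1 (N + 1) (-r s t) t‖ₑ ≤ V₂ N s :=
      le_iSup₂ (f := fun t (_ : t ∈ S) => ‖truncatedEvolution h 1 (N + 1) (-r s t) t‖ₑ) t ht
    have p1 : 2 * (ENNReal.ofReal C * ENNReal.ofReal Q) ≤ ENNReal.ofReal P := by
      rw [← ENNReal.ofReal_mul hC, show (2 : ℝ≥0∞) = ENNReal.ofReal 2 by simp,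
        ← ENNReal.ofReal_mul zero_le_two]
      refine ENNReal.ofReal_le_ofReal ?_
      have := norm_nonneg c₁
      have := norm_nonneg c₂
      linarith
    have p2 : ‖c₁‖ₑ ≤ ENNReal.ofReal P := by
      rw [← ofReal_norm]
      refine ENNReal.ofReal_le_ofReal ?_
      have : 0 ≤ 2 * C * Q := by positivity
      have := norm_nonneg c₂
      linarith
    have p3 : ‖c₂‖ₑ ≤ ENNReal.ofReal P := by
      rw [← ofReal_norm]
      refine ENNReal.ofReal_le_ofReal ?_
      have : 0 ≤ 2 * C * Q := by positivity
      have := norm_nonneg c₁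
      linarith
    have h2 : ‖besselEvolution μ h (Ioc 0 (N + 1)) t (r s t)‖ₑ ≤
        ENNReal.ofReal P * (X ^ (1 / 2 : ℝ) + V₁ N s + V₂ N s) := by
      refine h1.trans ?_
      calc _ ≤ 2 * (ENNReal.ofReal C * (ENNReal.ofReal Q * X ^ (1 / 2 : ℝ))) +
            (‖c₁‖ₑ * V₁ N s + ‖c₂‖ₑ * V₂ N s) := by gcongr
        _ = 2 * (ENNReal.ofReal C * ENNReal.ofReal Q) * X ^ (1 / 2 : ℝ) +
            (‖c₁‖ₑ * V₁ N s + ‖c₂‖ₑ * V₂ N s) := by ring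
        _ ≤ ENNReal.ofReal P * X ^ (1 / 2 : ℝ) +
            (ENNReal.ofReal P * V₁ N s + ENNReal.ofReal P * V₂ N s) := by gcongr
        _ = _ := by ring
    calc _ ≤ (ENNReal.ofReal P * (X ^ (1 / 2 : ℝ) + V₁ N s + V₂ N s)) ^ 2 := by gcongr
      _ = ENNReal.ofReal P ^ 2 * (X ^ (1 / 2 : ℝ) + V₁ N s + V₂ N s) ^ 2 := mul_pow _ _ _
      _ ≤ ENNReal.ofReal P ^ 2 * (9 * ((X ^ (1 / 2 : ℝ)) ^ 2 + V₁ N s ^ 2 + V₂ N s ^ 2)) := by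
          gcongr
          exact add_add_sq_le_nine_mul _ _ _
      _ = B N s := by rw [hXsq]
  have hsup : ∀ s ∈ Ioo δ₁ δ₂, (⨆ t ∈ S, ‖besselEvolution μ h (Ioi 0) t (r s t)‖ₑ) ^ 2 ≤
      Filter.liminf (fun N => B N s) Filter.atTop := by
    intro s hs
    rw [ENNReal.iSup_pow_of_ne_zero two_ne_zero]
    refine iSup_le fun t => ?_
    rw [ENNReal.iSup_pow_of_ne_zero two_ne_zero]
    exact iSup_le fun ht => enorm_setIntegral_Ioi_sq_le_liminf fun N => hpt N s hs t ht
  have hm₁ : ∀ N, AEMeasurable (fun s => V₁ N s ^ 2) (volume.restrict (Ioo δ₁ δ₂)) := fun N =>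
    (hmax₁ N).1.pow_const 2
  have hm₂ : ∀ N, AEMeasurable (fun s => V₂ N s ^ 2) (volume.restrict (Ioo δ₁ δ₂)) := fun N =>
    (hmax₂ N).1.pow_const 2
  have hBm : ∀ N, AEMeasurable (B N) (volume.restrict (Ioo δ₁ δ₂)) := fun N =>
    (((aemeasurable_const.add (hm₁ N)).add (hm₂ N)).const_mul 9).const_mul _
  have hBint : ∀ N, ∫⁻ s in Ioo δ₁ δ₂, B N s ≤
      ENNReal.ofReal (P ^ 2 * 9 * ((δ₂ - δ₁) + 2 * M)) * X := by
    intro N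
    have e1 : ∫⁻ s in Ioo δ₁ δ₂, B N s = ENNReal.ofReal P ^ 2 * (9 * (X * ENNReal.ofReal (δ₂ - δ₁) +
        (∫⁻ s in Ioo δ₁ δ₂, V₁ N s ^ 2) + ∫⁻ s in Ioo δ₁ δ₂, V₂ N s ^ 2)) := by
      simp only [hBdef]
      rw [lintegral_const_mul' _ _ (by finiteness), lintegral_const_mul' _ _ (by finiteness),
        lintegral_add_right' _ (hm₂ N), lintegral_add_right' _ (hm₁ N), setLIntegral_const,
        Real.volume_Ioo]
    rw [e1]
    have b1 : ∫⁻ s in Ioo δ₁ δ₂, V₁ N s ^ 2 ≤ ENNReal.ofReal M * X :=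
      (hmax₁ N).2.trans (by gcongr; exact hXN N)
    have b2 : ∫⁻ s in Ioo δ₁ δ₂, V₂ N s ^ 2 ≤ ENNReal.ofReal M * X :=
      (hmax₂ N).2.trans (by gcongr; exact hXN N)
    have hd : 0 ≤ δ₂ - δ₁ := by linarith
    calc _ ≤ ENNReal.ofReal P ^ 2 * (9 * (X * ENNReal.ofReal (δ₂ - δ₁) +
          ENNReal.ofReal M * X + ENNReal.ofReal M * X)) := by gcongr
      _ = _ := by
          rw [ENNReal.ofReal_mul (p := P ^ 2 * 9) (by positivity),
            ENNReal.ofReal_mul (p := P ^ 2) (by positivity), ENNReal.ofReal_pow hP0,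
            ENNReal.ofReal_add hd (by positivity),
            ENNReal.ofReal_mul zero_le_two]
          simp only [ENNReal.ofReal_ofNat]
          ring
  calc _ ≤ ∫⁻ s in Ioo δ₁ δ₂, Filter.liminf (fun N => B N s) Filter.atTop :=
        setLIntegral_mono_ae' measurableSet_Ioo (.of_forall hsup)
    _ ≤ Filter.liminf (fun N => ∫⁻ s in Ioo δ₁ δ₂, B N s) Filter.atTop := lintegral_liminf_le' hBm
    _ ≤ Filter.liminf (fun _ : ℕ => ENNReal.ofReal (P ^ 2 * 9 * ((δ₂ - δ₁) + 2 * M)) * X)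
        Filter.atTop := Filter.liminf_le_liminf (.of_forall hBint)
    _ = _ := Filter.liminf_const _

theorem aestronglyMeasurable_sphericalFourier {n : ℕ} (hn : 2 ≤ n) {f₀ : ℝ → ℂ}
    (hf₀ : AEStronglyMeasurable f₀ (volume.restrict (Ioi 0))) :
    AEStronglyMeasurable (sphericalFourier n f₀) volume := by
  have hn' : (2 : ℝ) ≤ n := by exact_mod_cast hn
  have hJ := continuous_modifiedBesselJ (μ := ((n : ℝ) - 2) / 2) (by linarith)
  have : AEStronglyMeasurable (fun z : ℝ × ℝ => f₀ z.2 *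
      modifiedBesselJ (((n : ℝ) - 2) / 2) (z.1 * z.2) * ((z.2 ^ (n - 1) : ℝ) : ℂ))
      (volume.prod (volume.restrict (Ioi 0))) :=
    (hf₀.comp_snd.mul (Continuous.aestronglyMeasurable (by fun_prop))).mul
      (Continuous.aestronglyMeasurable (by fun_prop))
  exact this.integral_prod_right'

theorem rpow_mul_self_eq_pow {n : ℕ} (hn : 2 ≤ n) {l : ℝ} (hl : 0 < l) :
    l ^ (((n : ℝ) - 2) / 2 + 1 / 2) * l ^ (((n : ℝ) - 2) / 2 + 1 / 2) = l ^ (n - 1) := by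
  rw [← Real.rpow_add hl, ← Real.rpow_natCast, Nat.cast_sub (by omega)]
  congr 1
  push_cast
  ring

theorem homSobolevNorm_eq {n : ℕ} (hn : 2 ≤ n) (f₀ : ℝ → ℂ) :
    homSobolevNorm n (1 / 4) f₀ = (∫⁻ l in Ioi (0 : ℝ), ‖((√√l : ℝ) : ℂ) *
      (((l ^ (((n : ℝ) - 2) / 2 + 1 / 2) : ℝ) : ℂ) * sphericalFourier n f₀ l)‖ₑ ^ 2) ^
        (1 / 2 : ℝ) := by
  rw [homSobolevNorm]
  congr 1
  refine setLIntegral_congr_fun measurableSet_Ioi fun l hl => ?_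
  have hl0 : (0 : ℝ) < l := hl
  have e1 : ∀ x : ℝ, 0 ≤ x → ‖((x : ℝ) : ℂ)‖ₑ = ENNReal.ofReal x := fun x hx => by
    rw [← ofReal_norm, Complex.norm_real, Real.norm_of_nonneg hx]
  rw [enorm_mul, enorm_mul, e1 _ (by positivity), e1 _ (by positivity), mul_pow, mul_pow,
    ← ENNReal.ofReal_pow (by positivity), ← ENNReal.ofReal_pow (by positivity),
    Real.sq_sqrt (by positivity), sq (l ^ _), rpow_mul_self_eq_pow hn hl0, Real.sqrt_eq_rpow,
    show (2 : ℝ) * (1 / 4) = 1 / 2 by norm_num]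
  ring

theorem schrodingerRadial_eq {n : ℕ} (hn : 2 ≤ n) (f₀ : ℝ → ℂ) (t : ℝ) {ρ : ℝ} (hρ : 0 < ρ) :
    ((ρ ^ (((n : ℝ) - 2) / 2 + 1 / 2) : ℝ) : ℂ) * schrodingerRadial n f₀ t ρ =
      besselEvolution (((n : ℝ) - 2) / 2) (fun l => ((l ^ (((n : ℝ) - 2) / 2 + 1 / 2) : ℝ) : ℂ) *
        sphericalFourier n f₀ l) (Ioi 0) t ρ := by
  rw [schrodingerRadial, besselEvolution, ← integral_const_mul]
  refine setIntegral_congr_fun measurableSet_Ioi fun l hl => ?_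
  have hl0 : (0 : ℝ) < l := hl
  rw [← rpow_mul_self_eq_pow hn hl0, Real.mul_rpow hl0.le hρ.le, mul_assoc Complex.I,
    ← Complex.ofReal_mul t]
  push_cast
  ring

end RadialSchrodinger

theorem mainTheorem4 (n : ℕ) (hn : 2 ≤ n) :
    ∃ ε₀ : ℝ, 0 < ε₀ ∧
      ∀ C₄ C₅ C₆ : ℝ, 0 < C₄ → 0 < C₅ → 0 < C₆ →
      ∀ δ₁ δ₂ : ℝ, 0 < δ₁ → δ₁ < δ₂ → C₆ * δ₂ ≤ ε₀ →
      ∃ C : ℝ, 0 < C ∧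
        ∀ α ∈ Set.Icc (1 / 2 : ℝ) 1,
        ∀ T : ℝ, 0 < T → T < (C₅ * δ₁ / (2 * C₄)) ^ (1 / α) →
        ∀ γ : ℝ → ℝ → EuclideanSpace ℝ (Fin n),
          (∀ s ∈ Set.Ico 0 δ₂, ‖γ s 0‖ = s) →
          RadialSchrodinger.HolderInTime γ δ₂ T α C₄ →
          RadialSchrodinger.BilipschitzInSpace γ δ₂ T C₅ C₆ →
        ∀ (f : SchwartzMap (EuclideanSpace ℝ (Fin n)) ℂ) (f₀ : ℝ → ℂ),
          (∀ x, f x = f₀ ‖x‖) →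
          (∫⁻ s in Set.Ioo δ₁ δ₂,
              (⨆ t ∈ Set.Icc (-T) T, ‖RadialSchrodinger.schrodingerRadial n f₀ t ‖γ s t‖‖ₑ) ^ 2 *
                ENNReal.ofReal (s ^ (n - 1))) ^ (1 / 2 : ℝ)
            ≤ ENNReal.ofReal C * RadialSchrodinger.homSobolevNorm n (1 / 4) f₀ := by
  -- the radii only have to stay in a compact subset of `(0, ∞)`, so any `ε₀` serves
  refine ⟨1, one_pos, fun C₄ C₅ C₆ hC₄ hC₅ hC₆ δ₁ δ₂ hδ₁ hδ _ => ?_⟩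
  have hn' : (2 : ℝ) ≤ n := by exact_mod_cast hn
  set μ : ℝ := ((n : ℝ) - 2) / 2 with hμdef
  have hμ : -1 / 2 < μ := by rw [hμdef]; linarith
  have hδ₂ : 0 < δ₂ := hδ₁.trans hδ
  have hρ₁ : 0 < δ₁ / 2 := by positivity
  obtain ⟨c₁, c₂, Cb, hCb, hdec⟩ :=
    RadialSchrodinger.exists_besselKernel_decomposition (ρ₂ := 2 * δ₂) hμ hρ₁
  obtain ⟨Q, hQ0, hQ⟩ := RadialSchrodinger.exists_lintegral_errorWeight_mul_le
  obtain ⟨c, hc, hker⟩ :=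
    RadialSchrodinger.exists_norm_oscKernel_curve_le hC₄ hC₅ hδ₂
  set K₀ := (2 * Cb * Q + ‖c₁‖ + ‖c₂‖) ^ 2 * 9 * ((δ₂ - δ₁) + 2 * (c * (4 * √(δ₂ - δ₁)))) with hK₀
  have hK₀0 : 0 ≤ K₀ := by
    have : 0 ≤ δ₂ - δ₁ := by linarith
    positivity
  set a := (δ₁ / 2) ^ (μ + 1 / 2) with ha
  have ha0 : 0 < a := by positivity
  -- `a` bounds `r_s(t)^{μ + 1/2}` from below; the summand `1` only makes the constant positive
  set K := δ₂ ^ (n - 1) * (a⁻¹ ^ 2 * K₀) + 1 with hK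
  have hK0 : 0 < K := by positivity
  refine ⟨√K, Real.sqrt_pos.2 hK0, ?_⟩
  intro α hα T hT0 hT γ hγ hH hB f f₀ hf
  have hα0 : 0 < α := by linarith [hα.1]
  set S := Icc (-T) T with hSdef
  have h0S : (0 : ℝ) ∈ S := ⟨by linarith, hT0.le⟩
  set I := Ioo δ₁ δ₂ with hIdef
  have hI : I ⊆ Ico 0 δ₂ := fun s hs => ⟨(hδ₁.trans hs.1).le, hs.2⟩
  -- at time `0` the bilipschitz bound is about `s` itself, which forces `C₅ ≤ 1`
  have hC₅1 : C₅ ≤ 1 := by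
    have h1 := (hB δ₁ ⟨hδ₁.le, hδ⟩ 0 ⟨le_rfl, hδ₂⟩ 0 h0S).1
    rw [hγ δ₁ ⟨hδ₁.le, hδ⟩, hγ 0 ⟨le_rfl, hδ₂⟩, sub_zero, abs_of_pos hδ₁] at h1
    exact le_of_mul_le_mul_right (by linarith) hδ₁
  have hTα : C₄ * T ^ α ≤ δ₁ / 2 := by
    have h1 : T ^ α ≤ C₅ * δ₁ / (2 * C₄) := by
      have := Real.rpow_le_rpow hT0.le hT.le hα0.le
      rwa [← Real.rpow_mul (by positivity), one_div_mul_cancel hα0.ne', Real.rpow_one] at this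
    rw [le_div_iff₀ (by positivity)] at h1
    have h2 : C₅ * δ₁ ≤ 1 * δ₁ := by gcongr
    linarith
  set r : ℝ → ℝ → ℝ := fun s t => ‖γ s t‖ with hr
  -- the curves with parameter in `(δ₁, δ₂)` stay away from the origin
  have hrange : ∀ s ∈ I, ∀ t ∈ S, r s t ∈ Icc (δ₁ / 2) (2 * δ₂) := by
    intro s hs t ht
    have h1 := hH s (hI hs) t ht 0 h0S
    rw [hγ s (hI hs), sub_zero] at h1
    have h2 : |t| ^ α ≤ T ^ α := Real.rpow_le_rpow (abs_nonneg t) (abs_le.2 ht) hα0.le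
    have h3 : |‖γ s t‖ - s| ≤ δ₁ / 2 := h1.trans ((by gcongr : C₄ * |t| ^ α ≤ C₄ * T ^ α).trans hTα)
    have h4 := abs_le.1 h3
    exact ⟨by simp only [hr]; linarith [hs.1, h4.1], by simp only [hr]; linarith [hs.2, h4.2]⟩
  have hrs : ∀ t ∈ S, ContinuousOn (fun s => r s t) I := fun t ht =>
    RadialSchrodinger.continuousOn_of_abs_sub_le_rpow (C := C₆) one_pos fun s hs s' hs' => by
      rw [Real.rpow_one]
      exact (hB s (hI hs) s' (hI hs') t ht).2
  have hrt : ∀ s ∈ I, ContinuousOn (r s) S := fun s hs =>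
    RadialSchrodinger.continuousOn_of_abs_sub_le_rpow hα0 fun t ht t' ht' =>
      hH s (hI hs) t ht t' ht'
  have hneg : ∀ x y : ℝ, |-x - -y| = |x - y| := fun x y => by
    rw [← abs_neg]; congr 1; ring
  have hker₁ := hker α hα S I r hI (fun s hs => hH s (hI hs))
    (fun s hs s' hs' t ht => (hB s (hI hs) s' (hI hs') t ht).1)
  have hker₂ := hker α hα S I (fun s t => -r s t) hI
    (fun s hs t ht t' ht' => by rw [hneg]; exact hH s (hI hs) t ht t' ht')
    (fun s hs s' hs' t ht => by rw [hneg]; exact (hB s (hI hs) s' (hI hs') t ht).1)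
  have hf₀ : AEStronglyMeasurable f₀ (volume.restrict (Ioi 0)) := by
    have hcont : Continuous fun s : ℝ =>
        f (s • (EuclideanSpace.single (⟨0, by omega⟩ : Fin n) (1 : ℝ))) := by fun_prop
    refine hcont.aestronglyMeasurable.congr ?_
    filter_upwards [ae_restrict_mem measurableSet_Ioi] with s hs
    rw [hf, norm_smul, Real.norm_of_nonneg (le_of_lt hs)]
    simp
  set h : ℝ → ℂ := fun l => ((l ^ (μ + 1 / 2) : ℝ) : ℂ) *
    RadialSchrodinger.sphericalFourier n f₀ l with hh
  have hhm : AEStronglyMeasurable h (volume.restrict (Ioi 0)) := by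
    refine AEStronglyMeasurable.mul (Measurable.aestronglyMeasurable (by fun_prop)) ?_
    exact (RadialSchrodinger.aestronglyMeasurable_sphericalFourier hn hf₀).restrict
  rw [RadialSchrodinger.homSobolevNorm_eq hn]
  set X := ∫⁻ l in Ioi (0 : ℝ), ‖((√√l : ℝ) : ℂ) * h l‖ₑ ^ 2 with hX
  change _ ≤ _ * X ^ (1 / 2 : ℝ)
  have hhalf : (0 : ℝ) < 1 / 2 := by norm_num
  rcases eq_or_ne X ∞ with hXtop | hXtop
  · rw [hXtop, ENNReal.top_rpow_of_pos hhalf,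
      ENNReal.mul_top (by simpa using Real.sqrt_pos.2 hK0)]
    exact le_top
  have key := RadialSchrodinger.lintegral_iSup_besselEvolution_sq_le hμ hCb hQ0 hc hδ hdec hQ
    ⟨0, h0S⟩ hrange hrs hrt hker₁ hker₂ hhm (lt_top_iff_ne_top.2 hXtop)
  have hpt : ∀ s ∈ I, (⨆ t ∈ S, ‖RadialSchrodinger.schrodingerRadial n f₀ t ‖γ s t‖‖ₑ) ^ 2 *
      ENNReal.ofReal (s ^ (n - 1)) ≤ ENNReal.ofReal (δ₂ ^ (n - 1) * a⁻¹ ^ 2) *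
        (⨆ t ∈ S, ‖RadialSchrodinger.besselEvolution μ h (Ioi 0) t (r s t)‖ₑ) ^ 2 := by
    intro s hs
    have hs0 : 0 < s := hδ₁.trans hs.1
    have h1 : (⨆ t ∈ S, ‖RadialSchrodinger.schrodingerRadial n f₀ t ‖γ s t‖‖ₑ) ≤
        ENNReal.ofReal a⁻¹ *
          ⨆ t ∈ S, ‖RadialSchrodinger.besselEvolution μ h (Ioi 0) t (r s t)‖ₑ := by
      refine iSup₂_le fun t ht => ?_
      have hrt0 := hrange s hs t ht
      have hr0 : 0 < r s t := hρ₁.trans_le hrt0.1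
      have h2 := RadialSchrodinger.schrodingerRadial_eq hn f₀ t hr0
      have h3 : ENNReal.ofReal a * ‖RadialSchrodinger.schrodingerRadial n f₀ t ‖γ s t‖‖ₑ ≤
          ‖RadialSchrodinger.besselEvolution μ h (Ioi 0) t (r s t)‖ₑ := by
        rw [hh, ← h2, enorm_mul]
        gcongr
        rw [← ofReal_norm, Complex.norm_real, Real.norm_of_nonneg (by positivity)]
        exact ENNReal.ofReal_le_ofReal (Real.rpow_le_rpow hρ₁.le hrt0.1 (by linarith))
      have h4 : ENNReal.ofReal a⁻¹ * ENNReal.ofReal a = 1 := by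
        rw [← ENNReal.ofReal_mul (by positivity), inv_mul_cancel₀ ha0.ne', ENNReal.ofReal_one]
      calc _ = ENNReal.ofReal a⁻¹ *
            (ENNReal.ofReal a * ‖RadialSchrodinger.schrodingerRadial n f₀ t ‖γ s t‖‖ₑ) := by
            rw [← mul_assoc, h4, one_mul]
        _ ≤ _ := by
            gcongr
            exact h3.trans (le_iSup₂ (f := fun t (_ : t ∈ S) =>
              ‖RadialSchrodinger.besselEvolution μ h (Ioi 0) t (r s t)‖ₑ) t ht)
    have h5 : ENNReal.ofReal (s ^ (n - 1)) ≤ ENNReal.ofReal (δ₂ ^ (n - 1)) :=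
      ENNReal.ofReal_le_ofReal (pow_le_pow_left₀ hs0.le hs.2.le _)
    refine (mul_le_mul' (pow_le_pow_left' h1 2) h5).trans (le_of_eq ?_)
    rw [mul_pow, ENNReal.ofReal_mul (by positivity), ENNReal.ofReal_pow (by positivity) 2]
    ring
  have hint : ∫⁻ s in I, (⨆ t ∈ S, ‖RadialSchrodinger.schrodingerRadial n f₀ t ‖γ s t‖‖ₑ) ^ 2 *
      ENNReal.ofReal (s ^ (n - 1)) ≤ ENNReal.ofReal K * X := by
    refine (setLIntegral_mono_ae' measurableSet_Ioo (.of_forall hpt)).trans ?_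
    rw [lintegral_const_mul' _ _ ENNReal.ofReal_ne_top]
    refine (mul_le_mul_right key _).trans ?_
    rw [← mul_assoc, ← ENNReal.ofReal_mul (by positivity)]
    gcongr
    rw [hK, mul_assoc]
    linarith
  refine (ENNReal.rpow_le_rpow hint hhalf.le).trans (le_of_eq ?_)
  rw [ENNReal.mul_rpow_of_nonneg _ _ hhalf.le, ENNReal.ofReal_rpow_of_nonneg hK0.le hhalf.le,
    Real.sqrt_eq_rpow]
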